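/- Let $n\ge 3$, let $\eta=\mathrm{diag}(1,1,-1,\dots,-1)$ and let $\mathfrak g=\mathfrak{so}(2,n)^{\mathbb C}$ be the Lie algebra of complex $(n+2)\times(n+2)$ matrices $A$ with $A^{T}\eta+\eta A=0$. Let $\mathfrak k\simeq(\mathfrak{so}(2)\oplus\mathfrak{so}(n))^{\mathbb C}$ be its subalgebra of block diagonal matrices, and let $r=\lfloor (n+2)/2\rfloor$. Let $j,k$ range over $\{-r,\dots,r\}$, with $0$ omitted when $n$ is even. With $f_{-1},f_0,f_1,\dots,f_n$ the standard basis of $\mathbb C^{n+2}$, put $e_j=f_{2j-3}+i f_{2j-2}$ for $j\ge1$, $e_{-1}=\frac12(f_{-1}-i f_0)$, $e_{-j}=-\frac12(f_{2j-3}-i f_{2j-2})$ for $j\ge2$ and, for odd $n$, $e_0=i f_n$; this is a basis of $\mathbb C^{n+2}$ with $e_j^{T}\eta\, e_k=\delta_{j,-k}$. Let $X_{jk}\in\mathfrak g$ be the map $v\mapsto (e_j^T\eta v)\,e_k-(e_k^T\eta v)\,e_j$. Then $X_{jk}=-X_{kj}$ and $$[X_{jk},X_{j'k'}]=\delta_{j,-j'}X_{kk'}+\delta_{k,-k'}X_{jj'}-\delta_{j,-k'}X_{kj'}-\delta_{k,-j'}X_{jk'}.$$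 Put $H_i=X_{-i,i}$ for $1\le i\le r$ and $\mathfrak p^{+}=\langle X_{1,j} : |j|\neq1\rangle$. Let $E_0>0$ be real and $\lambda=(-E_0,0,\dots,0)$. Let $K(\lambda)$ be the one-dimensional $\mathfrak k$-module on which $H_1$ acts by $-E_0$ and $\mathfrak{so}(n)^{\mathbb C}$ acts by $0$, extended to $\mathfrak k+\mathfrak p^+$ by letting $\mathfrak p^+$ act by $0$. Let $$N(\lambda)=\mathcal U(\mathfrak g)\otimes_{\mathcal U(\mathfrak k+\mathfrak p^+)}K(\lambda)$$ with highest weight vector $v_\lambda$, and let $L(\lambda)$ be its irreducible quotient, i.e. the quotient by the sum of all proper submodules. Put $\mathbf Z=\sum_{|h|\neq1}X_{-1,h}X_{-1,-h}\in\mathcal U(\mathfrak g)$ and $v_{lk}=(X_{-1,2})^{l}\,\mathbf Z^{k}v_\lambda\in N(\lambda)$ for integers $l,k\ge0$. Then: 1. $N(\lambda)=\bigoplus_{l,k\ge0}\mathcal U(\mathfrak k)v_{lk}$. 2. $N(\lambda)$ is irreducible if and only if $E_0\notin\{\frac n2-1,\dots,\frac n2-\lfloor\frac{n-1}2\rfloor\}$.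 3. If $E_0=\frac n2-j$ with $j\in\{1,\dots,\lfloor\frac{n-1}2\rfloor\}$, then $L(\lambda)$ is irreducible, the sum $\bigoplus_{l,k\ge0}\mathcal U(\mathfrak k)v_{l,j+k}$ is direct and is a $\mathfrak g$-submodule of $N(\lambda)$, and $$L(\lambda)\simeq N(\lambda)\Big/\bigoplus_{l,k\ge0}\mathcal U(\mathfrak k)v_{l,j+k}$$ as $\mathfrak g$-modules, compatibly with the projections from $N(\lambda)$. Moreover the projection $N(\lambda)\to L(\lambda)$ induces an isomorphism of $\mathfrak k$-modules $\bigoplus_{l\ge0}\bigoplus_{k=0}^{j-1}\mathcal U(\mathfrak k)v_{lk}\simeq L(\lambda)$. -/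

import Mathlib

open scoped TensorProduct DirectSum

noncomputable section

attribute [local instance 100] LieRing.ofAssociativeRing

/-! Modules induced from a Lie subalgebra. -/
namespace LieInduced

variable {R g V : Type*} [CommRing R] [LieRing g] [LieAlgebra R g]
  [AddCommGroup V] [Module R V]

/-- The `U(g)`-submodule of `U(g) ⊗ V` spanned by the elements `y ⊗ v - 1 ⊗ y v`, `y ∈ q`. -/
def relations (q : LieSubalgebra R g) (ρ : q →ₗ⁅R⁆ Module.End R V) :
    Submodule (UniversalEnvelopingAlgebra R g) (UniversalEnvelopingAlgebra R g ⊗[R] V) :=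
  Submodule.span (UniversalEnvelopingAlgebra R g)
    {t | ∃ (y : q) (v : V),
      t = (UniversalEnvelopingAlgebra.ι R (y : g)) ⊗ₜ[R] v
        - (1 : UniversalEnvelopingAlgebra R g) ⊗ₜ[R] (ρ y v)}

/-- The induced module `U(g) ⊗_{U(q)} V` of a `q`-module `(ρ, V)`, as a left `U(g)`-module. -/
abbrev Ind (q : LieSubalgebra R g) (ρ : q →ₗ⁅R⁆ Module.End R V) : Type _ :=
  (UniversalEnvelopingAlgebra R g ⊗[R] V) ⧸ relations q ρ

/-- The element `u ⊗ v` of the induced module. -/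
def Ind.tmul (q : LieSubalgebra R g) (ρ : q →ₗ⁅R⁆ Module.End R V)
    (u : UniversalEnvelopingAlgebra R g) (v : V) : Ind q ρ :=
  (relations q ρ).mkQ (u ⊗ₜ[R] v)

/-- The sum of all proper submodules; for a highest weight module this is the largest proper
submodule. -/
def maxProper (A M : Type*) [Ring A] [AddCommGroup M] [Module A M] : Submodule A M :=
  sSup {S | S ≠ ⊤}

end LieInduced

namespace SO2n

open Complex Matrix

/-- The complexification of `so(2,n)`: complex matrices `A` with `Aᵀ η + η A = 0`,
`η = diag(1,1,-1,…,-1)`. -/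
abbrev G (n : ℕ) : Type := LieAlgebra.Orthogonal.so' (Fin 2) (Fin n) ℂ

/-- The universal enveloping algebra of the complexification of `so(2,n)`. -/
abbrev U (n : ℕ) : Type := UniversalEnvelopingAlgebra ℂ (G n)

/-- The matrix `η = diag(1,1,-1,…,-1)`. -/
abbrev eta (n : ℕ) : Matrix (Fin 2 ⊕ Fin n) (Fin 2 ⊕ Fin n) ℂ :=
  LieAlgebra.Orthogonal.indefiniteDiagonal (Fin 2) (Fin n) ℂ

lemma mem_so' {n : ℕ} (A : Matrix (Fin 2 ⊕ Fin n) (Fin 2 ⊕ Fin n) ℂ) :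
    A ∈ LieAlgebra.Orthogonal.so' (Fin 2) (Fin n) ℂ ↔ Aᵀ * eta n = -(eta n * A) := by
  simp [LieAlgebra.Orthogonal.so', Matrix.IsSkewAdjoint, Matrix.IsAdjointPair]

/-- The complexification of the maximal compact subalgebra `so(2) ⊕ so(n)`: the block diagonal
elements. -/
def k (n : ℕ) : LieSubalgebra ℂ (G n) where
  carrier := {A | ∀ (a : Fin 2) (i : Fin n),
    A.1 (Sum.inl a) (Sum.inr i) = 0 ∧ A.1 (Sum.inr i) (Sum.inl a) = 0}
  add_mem' := fun {A B} hA hB a i => by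
    simp [(hA a i).1, (hA a i).2, (hB a i).1, (hB a i).2]
  zero_mem' := fun a i => by simp
  smul_mem' := fun c A hA a i => by simp [(hA a i).1, (hA a i).2]
  lie_mem' := fun {A B} hA hB a i => by
    have hA1 : ∀ a i, A.1 (Sum.inl a) (Sum.inr i) = 0 := fun a i => (hA a i).1
    have hA2 : ∀ a i, A.1 (Sum.inr i) (Sum.inl a) = 0 := fun a i => (hA a i).2
    have hB1 : ∀ a i, B.1 (Sum.inl a) (Sum.inr i) = 0 := fun a i => (hB a i).1
    have hB2 : ∀ a i, B.1 (Sum.inr i) (Sum.inl a) = 0 := fun a i => (hB a i).2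
    simp only [LieSubalgebra.coe_bracket, Ring.lie_def, Matrix.sub_apply, Matrix.mul_apply,
      Fintype.sum_sum_type, hA1, hA2, hB1, hB2]
    simp

/-- The image of `U(k)` in `U(g)`, i.e. the associative subalgebra generated by `k`. -/
def Uk (n : ℕ) : Subalgebra ℂ (U n) :=
  Algebra.adjoin ℂ (UniversalEnvelopingAlgebra.ι ℂ '' (k n : Set (G n)))

/-- The standard basis vectors `f_{-1}, f_0, f_1, …, f_n` of `ℂ^{2+n}`. -/
def f (n : ℕ) (a : ℤ) : Fin 2 ⊕ Fin n → ℂ :=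
  Sum.elim (fun i => if a = (i : ℤ) - 1 then 1 else 0) (fun i => if a = (i : ℤ) + 1 then 1 else 0)

/-- The matrix `v ↦ ⟨u, v⟩ w - ⟨w, v⟩ u`, where `⟨u, v⟩ = uᵀ η v`. -/
def wedgeMatrix {n : ℕ} (u w : Fin 2 ⊕ Fin n → ℂ) :
    Matrix (Fin 2 ⊕ Fin n) (Fin 2 ⊕ Fin n) ℂ :=
  vecMulVec w (u ᵥ* eta n) - vecMulVec u (w ᵥ* eta n)

lemma wedgeMatrix_mem {n : ℕ} (u w : Fin 2 ⊕ Fin n → ℂ) :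
    wedgeMatrix u w ∈ LieAlgebra.Orthogonal.so' (Fin 2) (Fin n) ℂ := by
  rw [mem_so']
  ext i j
  simp only [wedgeMatrix, eta, LieAlgebra.Orthogonal.indefiniteDiagonal, Matrix.mul_diagonal,
    Matrix.diagonal_mul, Matrix.transpose_apply, Matrix.sub_apply, vecMulVec_apply,
    vecMul_diagonal, Matrix.neg_apply]
  ring

/-- The element `v ↦ ⟨u, v⟩ w - ⟨w, v⟩ u` of the complexified `so(2,n)`. -/
def wedge {n : ℕ} (u w : Fin 2 ⊕ Fin n → ℂ) : G n := ⟨wedgeMatrix u w, wedgeMatrix_mem u w⟩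

/-- The rank `r` of the complexified `so(2,n)`. -/
def rk (n : ℕ) : ℕ := (n + 2) / 2

/-- The index set `{-r, …, r}`, where `0` occurs only for odd `n`. -/
def idx (n : ℕ) : Finset ℤ :=
  (Finset.Icc (-(rk n : ℤ)) (rk n)).filter (fun j => j ≠ 0 ∨ Odd n)

/-- A basis `(e_j)`, `j ∈ idx n`, of `ℂ^{2+n}` with `⟨e_j, e_k⟩ = δ_{j,-k}`; the vectors `e_{±1}`
span the two-dimensional positive part and the others the `n`-dimensional negative part. -/
def e (n : ℕ) (j : ℤ) : Fin 2 ⊕ Fin n → ℂ :=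
  if j = 0 then I • f n n
  else if 0 < j then f n (2 * j - 3) + I • f n (2 * j - 2)
  else (if j = -1 then (1 / 2 : ℂ) else -(1 / 2)) • (f n (-2 * j - 3) - I • f n (-2 * j - 2))

/-- The elements `X_{jk}`, `j, k ∈ idx n`: they satisfy `X_{jk} = -X_{kj}` and
`[X_{jk}, X_{j'k'}] = δ_{j,-j'} X_{kk'} + δ_{k,-k'} X_{jj'} - δ_{j,-k'} X_{kj'} - δ_{k,-j'} X_{jk'}`,
and the `X_{jk}` with `j < k` form a basis. -/
def X (n : ℕ) (j k : ℤ) : G n := wedge (e n j) (e n k)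

/-- `p⁺`, spanned by the `X_{1,j}` with `|j| ≠ 1`. -/
def pPlus (n : ℕ) : Submodule ℂ (G n) :=
  Submodule.span ℂ {A | ∃ j ∈ idx n, |j| ≠ 1 ∧ A = X n 1 j}

/-- The parabolic subalgebra `q = k + p⁺` (the Lie subalgebra generated by `k` and `p⁺`). -/
def q (n : ℕ) : LieSubalgebra ℂ (G n) :=
  LieSubalgebra.lieSpan ℂ (G n) ((k n : Set (G n)) ∪ (pPlus n : Set (G n)))

/-- `q` preserves the line spanned by `e_1`; `weight₁ A` is the eigenvalue of `A` there.
Thus `weight₁` vanishes on `p⁺` and on `so(n)`, and takes the value `1` at `H_1 = X_{-1,1}`. -/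
def weight₁ (n : ℕ) : G n →ₗ[ℂ] ℂ where
  toFun A := (A.1 *ᵥ e n 1) (Sum.inl 0)
  map_add' A B := by simp [Matrix.add_mulVec]
  map_smul' c A := by simp [Matrix.smul_mulVec]

lemma e_one (n : ℕ) : e n 1 = Sum.elim ![1, I] 0 := by
  ext (i | i)
  · fin_cases i <;> simp [e, f]
  · have h1 : ¬ (-1 : ℤ) = (i : ℤ) + 1 := by omega
    have h2 : ¬ (0 : ℤ) = (i : ℤ) + 1 := by omega
    simp [e, f, h1, h2]

lemma q_mulVec (n : ℕ) (A : G n) (hA : A ∈ q n) : A.1 *ᵥ e n 1 = weight₁ n A • e n 1 := by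
  let S : LieSubalgebra ℂ (G n) :=
    { carrier := {A | ∃ c : ℂ, A.1 *ᵥ e n 1 = c • e n 1}
      add_mem' := by
        rintro A B ⟨c, hc⟩ ⟨d, hd⟩
        exact ⟨c + d, by simp [Matrix.add_mulVec, hc, hd, add_smul]⟩
      zero_mem' := ⟨0, by simp⟩
      smul_mem' := by
        rintro t A ⟨c, hc⟩
        exact ⟨t * c, by simp [Matrix.smul_mulVec, hc, mul_smul]⟩
      lie_mem' := by
        rintro A B ⟨c, hc⟩ ⟨d, hd⟩
        refine ⟨0, ?_⟩
        simp only [LieSubalgebra.coe_bracket, Ring.lie_def, Matrix.sub_mulVec,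
          ← Matrix.mulVec_mulVec, hc, hd, Matrix.mulVec_smul, smul_smul, mul_comm c d]
        simp }
  have hS : q n ≤ S := by
    refine LieSubalgebra.lieSpan_le.2 (Set.union_subset ?_ ?_)
    · intro A hA
      have hs := (mem_so' A.1).1 A.2
      have h := fun a b => congrFun (congrFun hs (Sum.inl a)) (Sum.inl b)
      simp only [eta, LieAlgebra.Orthogonal.indefiniteDiagonal, Matrix.mul_diagonal,
        Matrix.diagonal_mul, Matrix.transpose_apply, Matrix.neg_apply, Sum.elim_inl, one_mul,
        mul_one] at h
      have h00 : A.1 (Sum.inl 0) (Sum.inl 0) = 0 := by linear_combination (h 0 0) / 2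
      have h11 : A.1 (Sum.inl 1) (Sum.inl 1) = 0 := by linear_combination (h 1 1) / 2
      have h01 := h 0 1
      refine ⟨A.1 (Sum.inl 0) (Sum.inl 1) * I, ?_⟩
      rw [e_one]
      ext (i | i)
      · fin_cases i
        · simp [Matrix.mulVec, dotProduct, h00]
        · simp [Matrix.mulVec, dotProduct, h11, h01, mul_assoc]
      · simp [Matrix.mulVec, dotProduct, (hA _ i).2]
    · change (pPlus n : Set (G n)) ⊆ (S.toSubmodule : Set (G n))
      refine Submodule.span_le.2 ?_
      rintro A ⟨j, -, -, rfl⟩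
      have key : ∀ u w : Fin 2 ⊕ Fin n → ℂ,
          (wedge u w).1 *ᵥ u = (u ᵥ* eta n ⬝ᵥ u) • w - (w ᵥ* eta n ⬝ᵥ u) • u := by
        intro u w
        ext i
        simp [wedge, wedgeMatrix, Matrix.sub_mulVec, vecMulVec_mulVec, mul_comm]
      have h0 : e n 1 ᵥ* eta n ⬝ᵥ e n 1 = 0 := by
        rw [e_one]
        simp [eta, LieAlgebra.Orthogonal.indefiniteDiagonal, dotProduct, vecMul_diagonal]
      refine ⟨-(e n j ᵥ* eta n ⬝ᵥ e n 1), ?_⟩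
      simp [X, key, h0]
  obtain ⟨c, hc⟩ := hS hA
  have : weight₁ n A = c := by
    change (A.1 *ᵥ e n 1) (Sum.inl 0) = c
    rw [hc, e_one]
    simp
  rw [this, hc]

/-- The one-dimensional module `K(λ)`, `λ = (-E₀,0,…,0)`, of `k`, with `p⁺` acting by zero:
`H_1` acts by `-E₀`, and `so(n)` and `p⁺` act by `0`. -/
def K (n : ℕ) (E₀ : ℝ) : q n →ₗ⁅ℂ⁆ Module.End ℂ ℂ where
  toFun A := (-(E₀ : ℂ) * weight₁ n A) • LinearMap.id
  map_add' A B := by simp [mul_add, add_smul]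
  map_smul' c A := by
    ext
    simp
    ring
  map_lie' := by
    intro A B
    have h : weight₁ n ⁅(A : G n), (B : G n)⁆ = 0 := by
      have hA := q_mulVec n A A.2
      have hB := q_mulVec n B B.2
      change ((⁅(A : G n), (B : G n)⁆ : G n).1 *ᵥ e n 1) (Sum.inl 0) = 0
      rw [LieSubalgebra.coe_bracket, Ring.lie_def, Matrix.sub_mulVec, ← Matrix.mulVec_mulVec,
        ← Matrix.mulVec_mulVec, hA, hB, Matrix.mulVec_smul, Matrix.mulVec_smul, hA, hB,
        smul_smul, smul_smul, mul_comm]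
      simp
    ext
    simp [h, Ring.lie_def]
    ring

/-- The induced highest weight module `N(λ) = U(g) ⊗_{U(q)} K(λ)`, `λ = (-E₀,0,…,0)`. -/
abbrev N (n : ℕ) (E₀ : ℝ) : Type := LieInduced.Ind (q n) (K n E₀)

/-- The irreducible quotient `L(λ)` of `N(λ)`: the quotient by the largest proper submodule. -/
abbrev L (n : ℕ) (E₀ : ℝ) : Type := N n E₀ ⧸ LieInduced.maxProper (U n) (N n E₀)

/-- The highest weight vector `v_λ = 1 ⊗ 1` of `N(λ)`. -/
def vTop (n : ℕ) (E₀ : ℝ) : N n E₀ := LieInduced.Ind.tmul (q n) (K n E₀) 1 1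

/-- `Z = ∑_{|h| ≠ 1} X_{-1,h} X_{-1,-h}` in `U(g)`. -/
def Z (n : ℕ) : U n :=
  ∑ h ∈ (idx n).filter (fun h => |h| ≠ 1),
    UniversalEnvelopingAlgebra.ι ℂ (X n (-1) h) * UniversalEnvelopingAlgebra.ι ℂ (X n (-1) (-h))

/-- `v_{lk} = (X_{-1,2})^l Z^k v_λ` in `N(λ)`. -/
def v (n : ℕ) (E₀ : ℝ) (l k : ℕ) : N n E₀ :=
  ((UniversalEnvelopingAlgebra.ι ℂ (X n (-1) 2)) ^ l * Z n ^ k) • vTop n E₀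

/-- The `U(k)`-submodule `U(k) v_{lk}` of `N(λ)`. -/
def Ukv (n : ℕ) (E₀ : ℝ) (l k : ℕ) : Submodule (Uk n) (N n E₀) :=
  Submodule.span (Uk n) {v n E₀ l k}

end SO2n

end

/-!
The module `N(λ)` is realized on the polynomials in `x₁, …, xₙ`: `p⁻` acts by multiplication with
linear forms, `k` by the Euler operator shifted by `E₀` and by infinitesimal rotations, and `p⁺` by
the special conformal operators `½ (a·x) Δ - (E + E₀) ∂ₐ`, where `E` is the Euler operator. In this
model `Z` is multiplication by `-|x|²` and `X_{-1,2}` is multiplication by an isotropic linear form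
`z`, so `v_{lk}` is `±z^l |x|^{2k}`, and `U(k) v_{lk}` consists of the products of `|x|^{2k}` with
the harmonic polynomials of degree `l`. The commuting operators `E` and `|x|² Δ` separate these
spaces.

A submodule of `N(λ)` is graded, and its nonzero elements of least degree are singular, i.e.
annihilated by `p⁺`. Singular polynomials of positive degree are rotation invariant, hence multiples
of some `|x|^{2j}`, and `|x|^{2j}` is singular exactly if `E₀ = n/2 - j`. In this case the multiples
of `|x|^{2j}` form the largest proper submodule.
-/

noncomputable section

namespace PolyOp

open MvPolynomial Matrix

section CommRing

variable {σ R : Type*} [CommRing R]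

/-- The Euler operator `∑ᵢ xᵢ ∂ᵢ`. -/
def euler : Derivation R (MvPolynomial σ R) (MvPolynomial σ R) := mkDerivation R X

/-- The directional derivative `∑ᵢ aᵢ ∂ᵢ`, linear in the direction `a`. -/
def dirDeriv : (σ → R) →ₗ[R] Derivation R (MvPolynomial σ R) (MvPolynomial σ R) :=
  (mkDerivationEquiv R).toLinearMap ∘ₗ (Algebra.linearMap R (MvPolynomial σ R)).compLeft σ

lemma linearMap_map_C_mul (f : MvPolynomial σ R →ₗ[R] MvPolynomial σ R) (c : R)
    (p : MvPolynomial σ R) : f (C c * p) = C c * f p := by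
  rw [← smul_eq_C_mul, map_smul, smul_eq_C_mul]

lemma derivation_map_C_mul (D : Derivation R (MvPolynomial σ R) (MvPolynomial σ R)) (c : R)
    (p : MvPolynomial σ R) : D (C c * p) = C c * D p :=
  linearMap_map_C_mul D.toLinearMap c p

@[simp] lemma euler_X (i : σ) : euler (X i) = (X i : MvPolynomial σ R) := mkDerivation_X ..

@[simp] lemma dirDeriv_X (a : σ → R) (i : σ) : dirDeriv a (X i) = C (a i) := mkDerivation_X ..

lemma commutator_apply_of_X {D₁ D₂ D₃ : Derivation R (MvPolynomial σ R) (MvPolynomial σ R)}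
    (h : ∀ i, D₁ (D₂ (X i)) - D₂ (D₁ (X i)) = D₃ (X i)) (p : MvPolynomial σ R) :
    D₁ (D₂ p) - D₂ (D₁ p) = D₃ p := by
  have : ⁅D₁, D₂⁆ = D₃ := derivation_ext fun i => by rw [Derivation.commutator_apply, h]
  rw [← this, Derivation.commutator_apply]

lemma dirDeriv_comm (a b : σ → R) (p : MvPolynomial σ R) :
    dirDeriv a (dirDeriv b p) = dirDeriv b (dirDeriv a p) :=
  sub_eq_zero.1 (commutator_apply_of_X (D₃ := 0) (fun i => by simp) p)

lemma euler_dirDeriv (a : σ → R) (p : MvPolynomial σ R) :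
    euler (dirDeriv a p) = dirDeriv a (euler p) - dirDeriv a p := by
  have h := commutator_apply_of_X (D₁ := euler) (D₂ := dirDeriv a) (D₃ := -dirDeriv a)
    (fun i => by simp) p
  rw [Derivation.neg_apply] at h
  linear_combination h

lemma euler_dirDeriv_of_euler {p : MvPolynomial σ R} {d : R}
    (hp : euler p = C d * p) (a : σ → R) :
    euler (dirDeriv a p) = C (d - 1) * dirDeriv a p := by
  rw [euler_dirDeriv, hp, derivation_map_C_mul, map_sub, sub_mul, map_one, one_mul]

@[simp] lemma dirDeriv_single [DecidableEq σ] (i : σ) :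
    dirDeriv (Pi.single i 1) = (pderiv i : Derivation R _ (MvPolynomial σ R)) := by
  refine derivation_ext fun j => ?_
  rw [dirDeriv_X, pderiv_X, Pi.single_apply, Pi.single_apply]
  split_ifs <;> simp_all

lemma pderiv_comm (i j : σ) (p : MvPolynomial σ R) :
    pderiv i (pderiv j p) = pderiv j (pderiv i p) := by
  classical simpa only [dirDeriv_single] using dirDeriv_comm (Pi.single i 1) (Pi.single j 1) p

variable [Fintype σ]

/-- The linear form `∑ᵢ aᵢ xᵢ`. -/
def linForm : (σ → R) →ₗ[R] MvPolynomial σ R :=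
  Fintype.linearCombination R X

/-- The linear vector field `∑ᵢⱼ Aᵢⱼ xᵢ ∂ⱼ`, which acts on linear forms through `A`. -/
def linField : Matrix σ σ R →ₗ[R] Derivation R (MvPolynomial σ R) (MvPolynomial σ R) :=
  (mkDerivationEquiv R).toLinearMap ∘ₗ
    linForm.compLeft σ ∘ₗ (transposeLinearEquiv σ σ R R).toLinearMap

/-- The Laplacian `∑ᵢ ∂ᵢ²`. -/
def laplacian : MvPolynomial σ R →ₗ[R] MvPolynomial σ R :=
  ∑ i, (pderiv i).toLinearMap ∘ₗ (pderiv i).toLinearMap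

/-- The quadratic form `∑ᵢ xᵢ²`. -/
def rsq : MvPolynomial σ R := ∑ i, X i ^ 2

lemma linForm_apply (a : σ → R) : linForm a = ∑ i, C (a i) * X i := by
  simp only [linForm, Fintype.linearCombination_apply, smul_eq_C_mul]

@[simp] lemma linForm_single [DecidableEq σ] (i : σ) :
    linForm (Pi.single i 1) = (X i : MvPolynomial σ R) := by
  simp [linForm]

@[simp] lemma linField_X (A : Matrix σ σ R) (i : σ) : linField A (X i) = linForm (A.col i) :=
  mkDerivation_X ..

lemma laplacian_apply (p : MvPolynomial σ R) : laplacian p = ∑ i, pderiv i (pderiv i p) := by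
  simp [laplacian]

lemma derivation_apply_eq_sum (D : Derivation R (MvPolynomial σ R) (MvPolynomial σ R))
    (p : MvPolynomial σ R) : D p = ∑ i, D (X i) * pderiv i p := by
  classical
  induction p using MvPolynomial.induction_on with
  | C c => simp
  | add p q hp hq => simp only [map_add, hp, hq, mul_add, Finset.sum_add_distrib]
  | mul_X p i hp =>
    simp only [Derivation.leibniz, smul_eq_mul, hp, pderiv_X, mul_add, Finset.sum_add_distrib,
      Finset.mul_sum]
    congr 1
    · simp [Pi.single_apply, mul_comm]
    · exact Finset.sum_congr rfl fun _ _ => by ring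

lemma euler_apply (p : MvPolynomial σ R) : euler p = ∑ i, X i * pderiv i p := by
  simp only [derivation_apply_eq_sum euler p, euler_X]

lemma dirDeriv_apply (a : σ → R) (p : MvPolynomial σ R) :
    dirDeriv a p = ∑ i, C (a i) * pderiv i p := by
  simp only [derivation_apply_eq_sum (dirDeriv a) p, dirDeriv_X]

lemma linField_apply (A : Matrix σ σ R) (p : MvPolynomial σ R) :
    linField A p = ∑ j, linForm (A.col j) * pderiv j p := by
  simp only [derivation_apply_eq_sum (linField A) p, linField_X]

lemma linField_vecMulVec (a b : σ → R) (p : MvPolynomial σ R) :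
    linField (vecMulVec a b) p = linForm a * dirDeriv b p := by
  have h (j : σ) : (vecMulVec a b).col j = b j • a := by
    ext i; simp [vecMulVec_apply, mul_comm]
  simp only [linField_apply, dirDeriv_apply, h, Finset.mul_sum, map_smul, smul_eq_C_mul]
  exact Finset.sum_congr rfl fun _ _ => by ring

@[simp] lemma dirDeriv_linForm (a b : σ → R) : dirDeriv a (linForm b) = C (a ⬝ᵥ b) := by
  simp [linForm_apply, dotProduct, mul_comm]

@[simp] lemma euler_linForm (b : σ → R) : euler (linForm b) = linForm b := by
  simp [linForm_apply]

@[simp] lemma linField_linForm (A : Matrix σ σ R) (b : σ → R) :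
    linField A (linForm b) = linForm (A *ᵥ b) := by
  have h : A *ᵥ b = ∑ i, b i • A.col i := by
    ext j; simp [mulVec, dotProduct, mul_comm]
  simp only [h, map_sum, map_smul, linForm_apply b, derivation_map_C_mul, linField_X, smul_eq_C_mul]

lemma dirDeriv_linForm_mul (a b : σ → R) (p : MvPolynomial σ R) :
    dirDeriv a (linForm b * p) = C (a ⬝ᵥ b) * p + linForm b * dirDeriv a p := by
  simp only [Derivation.leibniz, dirDeriv_linForm, smul_eq_mul]; ring

lemma euler_linForm_mul (b : σ → R) (p : MvPolynomial σ R) :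
    euler (linForm b * p) = linForm b * p + linForm b * euler p := by
  simp only [Derivation.leibniz, euler_linForm, smul_eq_mul]; ring

lemma linField_linForm_mul (A : Matrix σ σ R) (b : σ → R) (p : MvPolynomial σ R) :
    linField A (linForm b * p) = linForm (A *ᵥ b) * p + linForm b * linField A p := by
  simp only [Derivation.leibniz, linField_linForm, smul_eq_mul]; ring

lemma linField_dirDeriv (A : Matrix σ σ R) (a : σ → R) (p : MvPolynomial σ R) :
    linField A (dirDeriv a p) = dirDeriv a (linField A p) - dirDeriv (a ᵥ* A) p := by
  have h := commutator_apply_of_X (D₁ := linField A) (D₂ := dirDeriv a)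
    (D₃ := -dirDeriv (a ᵥ* A)) (fun i => by
      simp only [linField_X, dirDeriv_X, dirDeriv_linForm, derivation_C, zero_sub,
        Derivation.neg_apply]
      rfl) p
  rw [Derivation.neg_apply] at h
  linear_combination h

lemma linField_euler (A : Matrix σ σ R) (p : MvPolynomial σ R) :
    linField A (euler p) = euler (linField A p) :=
  sub_eq_zero.1 (commutator_apply_of_X (D₃ := 0) (fun i => by simp) p)

lemma linField_commutator (A B : Matrix σ σ R) (p : MvPolynomial σ R) :
    linField A (linField B p) - linField B (linField A p) = linField (A * B - B * A) p := by
  refine commutator_apply_of_X (fun i => ?_) p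
  have h : (A * B - B * A).col i = A *ᵥ B.col i - B *ᵥ A.col i := by
    ext j; simp [mul_apply, mulVec, dotProduct]
  simp only [linField_X (A * B - B * A), h, linField_X, linField_linForm, map_sub linForm]

lemma laplacian_linForm_mul (a : σ → R) (p : MvPolynomial σ R) :
    laplacian (linForm a * p) = linForm a * laplacian p + 2 * dirDeriv a p := by
  classical
  have h (i : σ) : pderiv i (pderiv i (linForm a * p)) =
      linForm a * pderiv i (pderiv i p) + 2 * (C (a i) * pderiv i p) := by
    simp only [← dirDeriv_single, dirDeriv_linForm_mul, map_add, derivation_map_C_mul,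
      single_one_dotProduct]
    ring
  simp only [laplacian_apply, dirDeriv_apply, h, Finset.sum_add_distrib, Finset.mul_sum]

lemma dirDeriv_laplacian (a : σ → R) (p : MvPolynomial σ R) :
    dirDeriv a (laplacian p) = laplacian (dirDeriv a p) := by
  classical simp only [laplacian_apply, map_sum, ← dirDeriv_single, dirDeriv_comm a]

lemma euler_laplacian (p : MvPolynomial σ R) :
    euler (laplacian p) = laplacian (euler p) - 2 * laplacian p := by
  classical
  simp only [laplacian_apply, map_sum, Finset.mul_sum, ← Finset.sum_sub_distrib]
  refine Finset.sum_congr rfl fun i _ => ?_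
  simp only [← dirDeriv_single, euler_dirDeriv, map_sub]
  ring

lemma two_mul_sum_skew_mul_symm {A : Matrix σ σ R} (hA : Aᵀ = -A)
    {f : σ → σ → MvPolynomial σ R} (hf : ∀ i j, f i j = f j i) :
    2 * ∑ i, ∑ j, C (A i j) * f i j = 0 := by
  have hswap : ∑ i, ∑ j, C (A i j) * f i j = -∑ i, ∑ j, C (A i j) * f i j := by
    conv_lhs => rw [Finset.sum_comm]
    simp only [← Finset.sum_neg_distrib]
    refine Finset.sum_congr rfl fun j _ => Finset.sum_congr rfl fun i _ => ?_
    have hij : A i j = -A j i := congrFun (congrFun hA j) i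
    rw [hij, hf i j, C_neg, neg_mul]
  linear_combination hswap

lemma linField_laplacian {A : Matrix σ σ R} (hA : Aᵀ = -A) (p : MvPolynomial σ R) :
    linField A (laplacian p) = laplacian (linField A p) := by
  classical
  have hterm (i : σ) : linField A (pderiv i (pderiv i p)) = pderiv i (pderiv i (linField A p)) -
      2 * ∑ j, C (A i j) * pderiv j (pderiv i p) := by
    have hrow : ∑ j, C (A i j) * pderiv j (pderiv i p) =
        dirDeriv (Pi.single i 1 ᵥ* A) (pderiv i p) := by
      simp [dirDeriv_apply]
    rw [hrow, ← dirDeriv_single, linField_dirDeriv, linField_dirDeriv, map_sub,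
      dirDeriv_comm (Pi.single i 1 ᵥ* A)]
    ring
  simp only [laplacian_apply, map_sum, hterm, Finset.sum_sub_distrib, ← Finset.mul_sum]
  rw [two_mul_sum_skew_mul_symm hA fun i j => pderiv_comm j i p, sub_zero]

lemma euler_rsq : euler (rsq : MvPolynomial σ R) = 2 * rsq := by
  simp only [rsq, map_sum, Finset.mul_sum, pow_two, Derivation.leibniz, euler_X, smul_eq_mul,
    two_mul]

lemma dirDeriv_rsq (a : σ → R) : dirDeriv a rsq = 2 * linForm a := by
  simp only [rsq, map_sum, Finset.mul_sum, linForm_apply, pow_two, Derivation.leibniz, dirDeriv_X,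
    smul_eq_mul]
  exact Finset.sum_congr rfl fun i _ => by ring

lemma linField_rsq {A : Matrix σ σ R} (hA : Aᵀ = -A) : linField A rsq = 0 := by
  have h := two_mul_sum_skew_mul_symm hA (f := fun i j => X i * X j) fun i j => mul_comm ..
  rw [Finset.sum_comm] at h
  rw [← h]
  simp only [rsq, map_sum, Finset.mul_sum, pow_two, Derivation.leibniz, linField_X, smul_eq_mul,
    linForm_apply, Matrix.col_apply, ← two_mul]
  exact Finset.sum_congr rfl fun i _ => Finset.sum_congr rfl fun j _ => by ring

lemma euler_rsq_mul (p : MvPolynomial σ R) : euler (rsq * p) = rsq * (euler p + 2 * p) := by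
  simp only [Derivation.leibniz, euler_rsq, smul_eq_mul]; ring

lemma dirDeriv_rsq_mul (a : σ → R) (p : MvPolynomial σ R) :
    dirDeriv a (rsq * p) = 2 * linForm a * p + rsq * dirDeriv a p := by
  simp only [Derivation.leibniz, dirDeriv_rsq, smul_eq_mul]; ring

lemma dirDeriv_rsq_pow_mul (a : σ → R) (m : ℕ) (p : MvPolynomial σ R) :
    dirDeriv a (rsq ^ (m + 1) * p) = rsq ^ (m + 1) * dirDeriv a p +
      2 * ((m : MvPolynomial σ R) + 1) * (rsq ^ m * linForm a * p) := by
  simp only [Derivation.leibniz, Derivation.leibniz_pow, dirDeriv_rsq, smul_eq_mul, nsmul_eq_mul,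
    add_tsub_cancel_right]
  push_cast
  ring

lemma linField_rsq_pow_mul {A : Matrix σ σ R} (hA : Aᵀ = -A) (m : ℕ) (p : MvPolynomial σ R) :
    linField A (rsq ^ m * p) = rsq ^ m * linField A p := by
  simp only [Derivation.leibniz, Derivation.leibniz_pow, linField_rsq hA, smul_zero, mul_zero,
    add_zero, smul_eq_mul]

lemma laplacian_rsq_mul (p : MvPolynomial σ R) :
    laplacian (rsq * p) =
      rsq * laplacian p + 4 * euler p + 2 * (Fintype.card σ : MvPolynomial σ R) * p := by
  classical
  have h (i : σ) : laplacian (X i ^ 2 * p) =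
      X i ^ 2 * laplacian p + 4 * (X i * pderiv i p) + 2 * p := by
    have hX (q : MvPolynomial σ R) : laplacian (X i * q) = X i * laplacian q + 2 * pderiv i q := by
      simpa using laplacian_linForm_mul (Pi.single i 1) q
    rw [pow_two, mul_assoc, hX, hX, pderiv_mul, pderiv_X_self]
    ring
  rw [rsq, Finset.sum_mul, map_sum]
  simp only [h, Finset.sum_add_distrib, ← Finset.sum_mul, ← Finset.mul_sum, ← euler_apply,
    Finset.sum_const, Finset.card_univ, nsmul_eq_mul]
  ring

end CommRing

section Conformal

variable {σ K : Type*} [Field K]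

lemma C_half_mul_two [NeZero (2 : K)] : (C 2⁻¹ : MvPolynomial σ K) * 2 = 1 := by
  rw [← map_ofNat C, ← C_mul, inv_mul_cancel₀ two_ne_zero, C_1]

variable [Fintype σ]

/-- The special conformal operator `½ (a·x) Δ - (E + s) ∂ₐ`, where `E` is the Euler operator and
`s` the scaling dimension; it is linear in `a`. -/
def conf (s : K) : (σ → K) →ₗ[K] Module.End K (MvPolynomial σ K) :=
  LinearMap.mk₂ K
    (fun a p => C 2⁻¹ * (linForm a * laplacian p) - (euler (dirDeriv a p) + C s * dirDeriv a p))
    (fun a b p => by simp only [map_add, Derivation.add_apply]; ring)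
    (fun c a p => by
      simp only [map_smul, Derivation.smul_apply, smul_eq_C_mul, derivation_map_C_mul]; ring)
    (fun a p q => by simp only [map_add]; ring)
    (fun c a p => by
      simp only [smul_eq_C_mul, derivation_map_C_mul, linearMap_map_C_mul]; ring)

lemma conf_apply (s : K) (a : σ → K) (p : MvPolynomial σ K) :
    conf s a p =
      C 2⁻¹ * (linForm a * laplacian p) - (euler (dirDeriv a p) + C s * dirDeriv a p) := rfl

lemma conf_C (s : K) (a : σ → K) (c : K) : conf s a (C c) = 0 := by
  simp only [conf_apply, laplacian_apply, derivation_C, map_zero, Finset.sum_const_zero, mul_zero,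
    add_zero, sub_zero]

lemma euler_conf (s : K) (a : σ → K) (p : MvPolynomial σ K) :
    euler (conf s a p) = conf s a (euler p) - conf s a p := by
  simp only [conf_apply, map_sub, map_add, derivation_map_C_mul, euler_linForm_mul,
    euler_laplacian, euler_dirDeriv]
  ring

lemma linField_conf {A : Matrix σ σ K} (hA : Aᵀ = -A) (s : K) (a : σ → K)
    (p : MvPolynomial σ K) :
    linField A (conf s a p) = conf s a (linField A p) + conf s (A *ᵥ a) p := by
  have h : a ᵥ* A = -(A *ᵥ a) := by rw [← mulVec_transpose, hA, neg_mulVec]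
  simp only [conf_apply, map_sub, map_add, derivation_map_C_mul, linField_linForm_mul,
    linField_laplacian hA, linField_euler, linField_dirDeriv, h, map_neg, Derivation.neg_apply]
  ring

lemma conf_linForm_mul [NeZero (2 : K)] (s : K) (a b : σ → K) (p : MvPolynomial σ K) :
    conf s a (linForm b * p) = linForm b * conf s a p + linForm a * dirDeriv b p -
      linForm b * dirDeriv a p - C (a ⬝ᵥ b) * (euler p + C s * p) := by
  simp only [conf_apply, dirDeriv_linForm_mul, laplacian_linForm_mul, map_add, euler_linForm_mul,
    derivation_map_C_mul]
  linear_combination (linForm a * dirDeriv b p) * (C_half_mul_two (σ := σ) (K := K))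

lemma conf_comm [NeZero (2 : K)] (s : K) (a b : σ → K) (p : MvPolynomial σ K) :
    conf s a (conf s b p) = conf s b (conf s a p) := by
  simp only [conf_apply, map_sub, map_add, derivation_map_C_mul, linearMap_map_C_mul,
    dirDeriv_linForm_mul, laplacian_linForm_mul, euler_linForm_mul, euler_dirDeriv,
    euler_laplacian, dirDeriv_laplacian, dirDeriv_comm b a, dotProduct_comm b a]
  linear_combination
    C 2⁻¹ * (linForm a * laplacian (dirDeriv b p) - linForm b * laplacian (dirDeriv a p)) *
      (C_half_mul_two (σ := σ) (K := K))

lemma conf_rsq_mul [NeZero (2 : K)] (s : K) (a : σ → K) (p : MvPolynomial σ K) :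
    conf s a (rsq * p) = rsq * conf s a p - 2 * rsq * dirDeriv a p +
      C (Fintype.card σ - 2 * s - 2) * (linForm a * p) := by
  have htwo (q : MvPolynomial σ K) : euler (2 * q) = 2 * euler q := by
    simpa only [map_ofNat] using derivation_map_C_mul euler (2 : K) q
  simp only [conf_apply, dirDeriv_rsq_mul, map_add, euler_rsq_mul, laplacian_rsq_mul, mul_assoc,
    htwo, euler_linForm_mul, map_sub, map_mul, map_natCast, map_ofNat]
  linear_combination (linForm a * (2 * euler p + (Fintype.card σ : MvPolynomial σ K) * p)) *
    (C_half_mul_two (σ := σ) (K := K))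

lemma conf_rsq_pow_mul [NeZero (2 : K)] (s : K) (a : σ → K) (m : ℕ) (p : MvPolynomial σ K) :
    conf s a (rsq ^ (m + 1) * p) =
      rsq ^ (m + 1) * (conf s a p - 2 * ((m : MvPolynomial σ K) + 1) * dirDeriv a p) +
      C ((m + 1) * (Fintype.card σ - 2 * (s + (m + 1)))) * (rsq ^ m * linForm a * p) := by
  induction m with
  | zero =>
    simp only [zero_add, pow_one, conf_rsq_mul, pow_zero, map_sub, map_mul, map_add, map_natCast,
      map_ofNat, map_one, Nat.cast_zero]
    ring
  | succ m ih =>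
    rw [pow_succ' _ (m + 1), mul_assoc, conf_rsq_mul, ih, dirDeriv_rsq_pow_mul]
    simp only [map_sub, map_mul, map_add, map_natCast, map_ofNat, map_one, Nat.cast_add,
      Nat.cast_one]
    ring

section Eigenvectors

variable {p : MvPolynomial σ K} {d : K}

lemma euler_laplacian_of_euler (hp : euler p = C d * p) :
    euler (laplacian p) = C (d - 2) * laplacian p := by
  rw [euler_laplacian, hp, linearMap_map_C_mul, map_sub, sub_mul, map_ofNat]

lemma euler_conf_of_euler (hp : euler p = C d * p) (s : K) (a : σ → K) :
    euler (conf s a p) = C (d - 1) * conf s a p := by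
  rw [euler_conf, hp, linearMap_map_C_mul, map_sub, sub_mul, map_one, one_mul]

lemma conf_of_euler (hp : euler p = C d * p) (s : K) (a : σ → K) :
    conf s a p = C 2⁻¹ * (linForm a * laplacian p) - C (d - 1 + s) * dirDeriv a p := by
  rw [conf_apply, euler_dirDeriv_of_euler hp, map_add, add_mul]

lemma sum_X_mul_conf [DecidableEq σ] (hp : euler p = C d * p) (s : K) :
    ∑ i, X i * conf s (Pi.single i 1) p =
      C 2⁻¹ * (rsq * laplacian p) - C (d * (d - 1 + s)) * p := by
  have hterm (i : σ) : X i * conf s (Pi.single i 1) p =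
      C 2⁻¹ * (X i ^ 2 * laplacian p) - C (d - 1 + s) * (X i * pderiv i p) := by
    rw [conf_of_euler hp, linForm_single, dirDeriv_single]
    ring
  simp only [hterm, Finset.sum_sub_distrib, ← Finset.mul_sum, ← Finset.sum_mul, ← euler_apply, hp,
    rsq, map_mul]
  ring

lemma sum_pderiv_conf [DecidableEq σ] [NeZero (2 : K)] (hp : euler p = C d * p) (s : K) :
    ∑ i, pderiv i (conf s (Pi.single i 1) p) =
      C (2⁻¹ * (Fintype.card σ - d - 2 * s)) * laplacian p := by
  have hterm (i : σ) : pderiv i (conf s (Pi.single i 1) p) =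
      C 2⁻¹ * (laplacian p + X i * pderiv i (laplacian p)) -
        C (d - 1 + s) * pderiv i (pderiv i p) := by
    rw [conf_of_euler hp, map_sub, derivation_map_C_mul, derivation_map_C_mul, linForm_single,
      dirDeriv_single, pderiv_mul, pderiv_X_self, one_mul]
  simp only [hterm, Finset.sum_sub_distrib, ← Finset.mul_sum, Finset.sum_add_distrib,
    Finset.sum_const, Finset.card_univ, nsmul_eq_mul, ← euler_apply, ← laplacian_apply,
    euler_laplacian_of_euler hp, map_sub, map_add, map_mul, map_natCast, map_ofNat, map_one]
  linear_combination ((C s + C d - 1) * laplacian p) * (C_half_mul_two (σ := σ) (K := K))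

end Eigenvectors

end Conformal

section Homogeneous

variable {σ R : Type*} [CommRing R]

lemma euler_monomial (m : σ →₀ ℕ) (c : R) : euler (monomial m c) = m.degree • monomial m c := by
  have h (i : σ) : monomial (m - .single i 1) (m i : R) • X i = m i • monomial m (1 : R) := by
    rw [← X_mul_pderiv_monomial, pderiv_monomial, one_mul, smul_eq_mul, mul_comm]
  rw [euler, mkDerivation_monomial, Finsupp.sum, Finset.sum_congr rfl fun i _ => h i,
    ← Finset.sum_smul, smul_comm, smul_monomial, smul_eq_mul, mul_one]
  rfl

lemma coeff_euler (m : σ →₀ ℕ) (p : MvPolynomial σ R) :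
    coeff m (euler p) = m.degree * coeff m p := by
  classical
  induction p using MvPolynomial.induction_on' with
  | monomial m' c =>
    rw [euler_monomial, coeff_smul, nsmul_eq_mul, coeff_monomial]
    split_ifs with h
    · rw [h]
    · rw [mul_zero, mul_zero]
  | add p q hp hq => simp only [map_add, coeff_add, hp, hq, mul_add]

lemma euler_of_isHomogeneous {p : MvPolynomial σ R} {d : ℕ} (hp : p.IsHomogeneous d) :
    euler p = C (d : R) * p := by
  ext m
  rw [coeff_euler, coeff_C_mul]
  by_cases hm : coeff m p = 0
  · rw [hm, mul_zero, mul_zero]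
  · rw [Finsupp.degree_eq_weight_one]
    congr 2
    exact hp hm

lemma isHomogeneous_rsq [Fintype σ] : (rsq : MvPolynomial σ R).IsHomogeneous 2 :=
  IsHomogeneous.sum _ _ _ fun i _ => (isHomogeneous_X R i).pow 2

variable [IsDomain R]

lemma degree_eq_of_euler {p : MvPolynomial σ R} {c : R} (hp : euler p = C c * p) {m : σ →₀ ℕ}
    (hm : coeff m p ≠ 0) : (m.degree : R) = c := by
  have h := congrArg (coeff m) hp
  rw [coeff_euler, coeff_C_mul] at h
  exact mul_right_cancel₀ hm h

lemma exists_natCast_eq_of_euler {p : MvPolynomial σ R} {c : R} (hp : euler p = C c * p)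
    (hp0 : p ≠ 0) : ∃ d : ℕ, (d : R) = c := by
  obtain ⟨m, hm⟩ := ne_zero_iff.1 hp0
  exact ⟨m.degree, degree_eq_of_euler hp hm⟩

variable [CharZero R]

lemma isHomogeneous_of_euler {p : MvPolynomial σ R} {d : ℕ} (hp : euler p = C (d : R) * p) :
    p.IsHomogeneous d := fun m hm => by
  have h : m.degree = d := by exact_mod_cast degree_eq_of_euler hp hm
  rw [← h, Finsupp.degree_eq_weight_one]
  rfl

lemma rsq_ne_zero [Fintype σ] [Nonempty σ] : (rsq : MvPolynomial σ R) ≠ 0 := fun h => by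
  classical
  obtain ⟨i⟩ := ‹Nonempty σ›
  have hi := dirDeriv_rsq (R := R) (Pi.single i 1)
  rw [h, map_zero, linForm_single] at hi
  exact X_ne_zero i ((mul_eq_zero.1 hi.symm).resolve_left two_ne_zero)

end Homogeneous

section RadialPolynomials

variable {σ K : Type*} [Field K]

lemma exists_pderiv_eq_X_mul [Nontrivial σ] {p : MvPolynomial σ K}
    (hp : ∀ i j, X j * pderiv i p = X i * pderiv j p) : ∃ q, ∀ i, pderiv i p = X i * q := by
  obtain ⟨i₀, j₀, hij⟩ := exists_pair_ne σ
  have hdvd : (X i₀ : MvPolynomial σ K) ∣ pderiv i₀ p := by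
    refine (X_prime.dvd_or_dvd (⟨_, hp i₀ j₀⟩ : X i₀ ∣ X j₀ * pderiv i₀ p)).resolve_left ?_
    rwa [X_dvd_X]
  obtain ⟨q, hq⟩ := hdvd
  refine ⟨q, fun i => mul_left_cancel₀ (X_ne_zero i₀) ?_⟩
  rw [← hp, hq]
  ring

variable [Fintype σ]

lemma X_mul_pderiv_comm_of_conf_eq_zero {p : MvPolynomial σ K} {d s : K}
    (hp : euler p = C d * p) (hds : d - 1 + s ≠ 0) (hconf : ∀ a, conf s a p = 0) (i j : σ) :
    X j * pderiv i p = X i * pderiv j p := by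
  classical
  have h (i : σ) : C (d - 1 + s) * pderiv i p = C 2⁻¹ * (X i * laplacian p) := by
    have hi := conf_of_euler hp s (Pi.single i 1)
    rw [hconf, linForm_single, dirDeriv_single] at hi
    linear_combination hi
  refine mul_left_cancel₀ (C_ne_zero.2 hds) ?_
  linear_combination X j * h i - X i * h j

variable [CharZero K]

lemma exists_eq_C_mul_rsq_pow [Nontrivial σ] {d : ℕ} {p : MvPolynomial σ K}
    (hd : p.IsHomogeneous d) (hp : ∀ i j, X j * pderiv i p = X i * pderiv j p) (hp0 : p ≠ 0) :
    ∃ (m : ℕ) (c : K), d = 2 * m ∧ p = C c * rsq ^ m := by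
  classical
  induction d using Nat.strong_induction_on generalizing p with
  | _ d ih =>
    rcases Nat.eq_zero_or_pos d with rfl | hdpos
    · exact ⟨0, coeff 0 p, rfl, by
        rw [pow_zero, mul_one, ← totalDegree_eq_zero_iff_eq_C.1 (hd.totalDegree hp0)]⟩
    have hdK : (d : K) ≠ 0 := Nat.cast_ne_zero.2 hdpos.ne'
    have hep := euler_of_isHomogeneous hd
    obtain ⟨q, hq⟩ := exists_pderiv_eq_X_mul hp
    have hpq : p = C (d : K)⁻¹ * (rsq * q) := by
      have h : C (d : K) * p = rsq * q := by
        simp only [← hep, euler_apply, hq, rsq, pow_two, mul_assoc, Finset.sum_mul]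
      rw [← h, ← mul_assoc, ← C_mul, inv_mul_cancel₀ hdK, C_1, one_mul]
    have hq0 : q ≠ 0 := by
      rintro rfl
      exact hp0 (by rw [hpq, mul_zero, mul_zero])
    have heq : euler q = C (d - 2 : K) * q := by
      obtain ⟨i⟩ : Nonempty σ := inferInstance
      have h := euler_dirDeriv_of_euler hep (Pi.single i 1)
      rw [dirDeriv_single, hq, Derivation.leibniz, euler_X, smul_eq_mul, smul_eq_mul] at h
      refine mul_left_cancel₀ (X_ne_zero i) ?_
      simp only [map_sub, map_one, map_ofNat] at h ⊢
      linear_combination h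
    have hqrad (i j : σ) : X j * pderiv i q = X i * pderiv j q := by
      rcases eq_or_ne i j with rfl | hij
      · rfl
      have h := pderiv_comm i j p
      rw [hq, hq, pderiv_mul, pderiv_mul, pderiv_X_of_ne hij, pderiv_X_of_ne hij.symm] at h
      linear_combination h
    obtain ⟨k, hk⟩ := exists_natCast_eq_of_euler heq hq0
    have hkd : k + 2 = d := by exact_mod_cast (eq_sub_iff_add_eq.1 hk)
    obtain ⟨m, c, rfl, rfl⟩ := ih k (by omega) (isHomogeneous_of_euler (hk ▸ heq)) hqrad hq0
    exact ⟨m + 1, (d : K)⁻¹ * c, by omega, by rw [hpq, C_mul]; ring⟩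

lemma exists_eq_C_mul_rsq_pow_of_conf_eq_zero [Nontrivial σ] {p : MvPolynomial σ K} {d : ℕ}
    {s : K} (hd : p.IsHomogeneous d) (hp0 : p ≠ 0) (hd0 : d ≠ 0) (hds : (d : K) - 1 + s ≠ 0)
    (hconf : ∀ a, conf s a p = 0) :
    ∃ (m : ℕ) (c : K), d = 2 * m ∧ p = C c * rsq ^ m ∧ (Fintype.card σ : K) = 2 * (s + m) := by
  classical
  obtain ⟨m, c, rfl, rfl⟩ := exists_eq_C_mul_rsq_pow hd
    (X_mul_pderiv_comm_of_conf_eq_zero (euler_of_isHomogeneous hd) hds hconf) hp0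
  refine ⟨m, c, rfl, rfl, ?_⟩
  obtain ⟨m, rfl⟩ := Nat.exists_eq_succ_of_ne_zero (right_ne_zero_of_mul hd0)
  obtain ⟨i⟩ : Nonempty σ := inferInstance
  have h := hconf (Pi.single i 1)
  rw [mul_comm, conf_rsq_pow_mul, conf_C, derivation_C, mul_zero, sub_zero, mul_zero, zero_add,
    linForm_single] at h
  have hne : rsq ^ m * X i * C c ≠ 0 :=
    mul_ne_zero (mul_ne_zero (pow_ne_zero _ rsq_ne_zero) (X_ne_zero i)) (left_ne_zero_of_mul hp0)
  have hcoeff := C_eq_zero.1 ((mul_eq_zero.1 h).resolve_right hne)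
  have hcard := (mul_eq_zero.1 hcoeff).resolve_left (Nat.cast_add_one_ne_zero m)
  rw [sub_eq_zero.1 hcard, Nat.succ_eq_add_one, Nat.cast_add_one]

end RadialPolynomials

section RsqDivisibility

variable {σ K : Type*} [Field K]

lemma dvd_of_dvd_C_mul {p q : MvPolynomial σ K} {c : K} (hc : c ≠ 0) (h : q ∣ C c * p) : q ∣ p :=
  ((IsUnit.mk0 c hc).map C).dvd_mul_left.1 h

variable [Fintype σ]

lemma rsq_pow_dvd_pderiv {m : ℕ} {p : MvPolynomial σ K} (h : rsq ^ (m + 1) ∣ p) (i : σ) :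
    rsq ^ m ∣ pderiv i p := by
  classical
  obtain ⟨p, rfl⟩ := h
  rw [← dirDeriv_single, dirDeriv_rsq_pow_mul]
  exact dvd_add ((pow_dvd_pow _ m.le_succ).mul_right _)
    (((dvd_mul_right _ _).mul_right _).mul_left _)

lemma rsq_pow_dvd_of_dvd_conf [DecidableEq σ] [NeZero (2 : K)] {p : MvPolynomial σ K} {d s : K}
    {m : ℕ} (hp : euler p = C d * p) (hd : d * (d - 1 + s) ≠ 0)
    (hds : (Fintype.card σ : K) - d - 2 * s ≠ 0)
    (hdvd : ∀ i, rsq ^ (m + 1) ∣ conf s (Pi.single i 1) p) : rsq ^ (m + 1) ∣ p := by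
  have hlap : rsq ^ m ∣ laplacian p := by
    refine dvd_of_dvd_C_mul (mul_ne_zero (inv_ne_zero two_ne_zero) hds) ?_
    rw [← sum_pderiv_conf hp s]
    exact Finset.dvd_sum fun i _ => rsq_pow_dvd_pderiv (hdvd i) i
  have hsum : rsq ^ (m + 1) ∣ ∑ i, X i * conf s (Pi.single i 1) p :=
    Finset.dvd_sum fun i _ => (hdvd i).mul_left _
  have hrsq : (rsq : MvPolynomial σ K) ^ (m + 1) ∣ C 2⁻¹ * (rsq * laplacian p) := by
    rw [pow_succ']
    exact (mul_dvd_mul_left _ hlap).mul_left _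
  have h := dvd_sub hrsq hsum
  rw [sum_X_mul_conf hp s, sub_sub_cancel] at h
  exact dvd_of_dvd_C_mul hd h

lemma eq_zero_of_rsq_pow_dvd [CharZero K] {p : MvPolynomial σ K} {d m : ℕ}
    (hp : p.IsHomogeneous d) (hdm : d < 2 * m) (hdvd : rsq ^ m ∣ p) : p = 0 := by
  by_contra hp0
  obtain ⟨q, rfl⟩ := hdvd
  have hr := (isHomogeneous_rsq.pow m).totalDegree (left_ne_zero_of_mul hp0)
  have ht := hp.totalDegree hp0
  rw [totalDegree_mul_of_isDomain (left_ne_zero_of_mul hp0) (right_ne_zero_of_mul hp0), hr] at ht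
  omega

end RsqDivisibility

section EigenvectorSums

lemma mem_of_sum_mem_of_apply_eq_smul {ι K V : Type*} [Field K] [AddCommGroup V] [Module K V]
    {f : Module.End K V} {S : Submodule K V} (hS : ∀ x ∈ S, f x ∈ S) {μ : ι → K}
    (hμ : Function.Injective μ) {x : ι → V} (hx : ∀ i, f (x i) = μ i • x i) {t : Finset ι}
    (hsum : ∑ i ∈ t, x i ∈ S) {i : ι} (hi : i ∈ t) : x i ∈ S := by
  have hind := (Module.End.eigenspaces_iSupIndep (S.mapQ S f hS)).comp hμ
  rw [← Submodule.ker_mkQ S, LinearMap.mem_ker]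
  refine (iSupIndep_iff_finsetSum_eq_zero_imp_eq_zero _).1 hind t (fun i => S.mkQ (x i))
    (fun i _ => ?_) ?_ i hi
  · rw [Function.comp_apply, Module.End.mem_eigenspace_iff, Submodule.mkQ_apply,
      Submodule.mapQ_apply, hx, Submodule.Quotient.mk_smul]
  · rwa [← map_sum, ← LinearMap.mem_ker, Submodule.ker_mkQ]

lemma homogeneousComponent_mem {σ K : Type*} [Field K] [CharZero K]
    {S : Submodule K (MvPolynomial σ K)} (hS : ∀ p ∈ S, euler p ∈ S) {p : MvPolynomial σ K}
    (hp : p ∈ S) (d : ℕ) : homogeneousComponent d p ∈ S := by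
  by_cases hd : d ∈ Finset.range (p.totalDegree + 1)
  · refine mem_of_sum_mem_of_apply_eq_smul (f := euler.toLinearMap) (S := S) hS
      (Nat.cast_injective (R := K)) (x := fun d => homogeneousComponent d p) (fun d => ?_) ?_ hd
    · rw [smul_eq_C_mul]
      exact euler_of_isHomogeneous (homogeneousComponent_isHomogeneous d p)
    · rwa [sum_homogeneousComponent]
  · rw [homogeneousComponent_eq_zero d p (by rw [Finset.mem_range] at hd; omega)]
    exact S.zero_mem

end EigenvectorSums

section StableSubspaces

variable {σ K : Type*} [Field K]

lemma eq_top_of_X_mul_mem {S : Submodule K (MvPolynomial σ K)}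
    (hS : ∀ i, ∀ p ∈ S, X i * p ∈ S) (h1 : 1 ∈ S) : S = ⊤ := by
  refine (Submodule.eq_top_iff').2 fun p => ?_
  induction p using MvPolynomial.induction_on with
  | C c => simpa only [smul_eq_C_mul, mul_one] using S.smul_mem c h1
  | add p q hp hq => exact add_mem hp hq
  | mul_X p i hp => exact mul_comm p (X i) ▸ hS i p hp

lemma one_mem_of_isHomogeneous_zero {S : Submodule K (MvPolynomial σ K)} {p : MvPolynomial σ K}
    (hp : p.IsHomogeneous 0) (hp0 : p ≠ 0) (hpS : p ∈ S) : 1 ∈ S := by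
  have hC := totalDegree_eq_zero_iff_eq_C.1 (hp.totalDegree hp0)
  have hc : coeff 0 p ≠ 0 := fun h => hp0 (by rw [hC, h, C_0])
  have h := S.smul_mem (coeff 0 p)⁻¹ hpS
  rwa [hC, smul_eq_C_mul, ← C_mul, coeff_zero_C, inv_mul_cancel₀ hc, C_1] at h

variable [Fintype σ]

/-- Stability of a space of polynomials under the Euler operator and the rotations. -/
structure RotStable (S : Submodule K (MvPolynomial σ K)) : Prop where
  euler_mem {p : MvPolynomial σ K} (hp : p ∈ S) : euler p ∈ S
  linField_mem {A : Matrix σ σ K} (hA : Aᵀ = -A) {p : MvPolynomial σ K} (hp : p ∈ S) :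
    linField A p ∈ S

/-- Stability of a space of polynomials under the conformal Lie algebra, acting with scaling
dimension `s`: besides the Euler operator and the rotations, it is generated by the
multiplications by linear forms and the special conformal operators. -/
structure ConfStable (s : K) (S : Submodule K (MvPolynomial σ K)) : Prop extends RotStable S where
  linForm_mem (a : σ → K) {p : MvPolynomial σ K} (hp : p ∈ S) : linForm a * p ∈ S
  conf_mem (a : σ → K) {p : MvPolynomial σ K} (hp : p ∈ S) : conf s a p ∈ S

/-- The multiples of `rsq ^ j`, as a space of polynomials. -/
def rsqMultiples (σ K : Type*) [Fintype σ] [Field K] (j : ℕ) : Submodule K (MvPolynomial σ K) :=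
  (Ideal.span {(rsq : MvPolynomial σ K) ^ j}).restrictScalars K

lemma mem_rsqMultiples {j : ℕ} {p : MvPolynomial σ K} : p ∈ rsqMultiples σ K j ↔ rsq ^ j ∣ p :=
  Ideal.mem_span_singleton

lemma confStable_rsqMultiples [NeZero (2 : K)] {s : K} {j : ℕ}
    (hj : (Fintype.card σ : K) = 2 * (s + j)) : ConfStable s (rsqMultiples σ K j) where
  euler_mem hp := by
    obtain ⟨p, rfl⟩ := mem_rsqMultiples.1 hp
    rw [mem_rsqMultiples, Derivation.leibniz, euler_of_isHomogeneous (isHomogeneous_rsq.pow j)]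
    exact dvd_add (dvd_mul_right _ _) ((dvd_mul_left _ _).mul_left _)
  linField_mem hA p hp := by
    obtain ⟨p, rfl⟩ := mem_rsqMultiples.1 hp
    rw [mem_rsqMultiples, linField_rsq_pow_mul hA]
    exact dvd_mul_right _ _
  linForm_mem a p hp := mem_rsqMultiples.2 ((mem_rsqMultiples.1 hp).mul_left _)
  conf_mem a p hp := by
    obtain ⟨p, rfl⟩ := mem_rsqMultiples.1 hp
    rw [mem_rsqMultiples]
    cases j with
    | zero => exact pow_zero (rsq : MvPolynomial σ K) ▸ one_dvd _
    | succ m =>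
      rw [Nat.cast_succ] at hj
      rw [conf_rsq_pow_mul, hj, sub_self, mul_zero, C_0, zero_mul, add_zero]
      exact dvd_mul_right _ _

lemma conf_eq_zero_of_isHomogeneous_zero {p : MvPolynomial σ K} (hp : p.IsHomogeneous 0) (s : K)
    (a : σ → K) : conf s a p = 0 := by
  rw [totalDegree_eq_zero_iff_eq_C.1 (Nat.le_zero.1 hp.totalDegree_le), conf_C]

lemma ConfStable.eq_top {s : K} {S : Submodule K (MvPolynomial σ K)} (hS : ConfStable s S)
    (h1 : 1 ∈ S) : S = ⊤ := by
  classical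
  exact eq_top_of_X_mul_mem (fun i p hp => linForm_single (R := K) i ▸ hS.linForm_mem _ hp) h1

variable [CharZero K]

lemma isHomogeneous_conf {p : MvPolynomial σ K} {d : ℕ} (hp : p.IsHomogeneous (d + 1)) (s : K)
    (a : σ → K) : (conf s a p).IsHomogeneous d := by
  apply isHomogeneous_of_euler
  rw [euler_conf_of_euler (euler_of_isHomogeneous hp), Nat.cast_succ, add_sub_cancel_right]

namespace ConfStable

variable {s : K} {S W : Submodule K (MvPolynomial σ K)}

/-- The witness is a homogeneous element of `S` outside `W` of least degree. -/
lemma exists_conf_mem (hS : ConfStable s S) (hSW : ¬S ≤ W) :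
    ∃ d p, p.IsHomogeneous d ∧ p ∈ S ∧ p ∉ W ∧ ∀ a, conf s a p ∈ W := by
  classical
  have hex : ∃ d p, p.IsHomogeneous d ∧ p ∈ S ∧ p ∉ W := by
    obtain ⟨p, hpS, hpW⟩ := SetLike.not_le_iff_exists.1 hSW
    by_contra! hcon
    refine hpW (sum_homogeneousComponent p ▸ W.sum_mem fun d _ => ?_)
    exact hcon d _ (homogeneousComponent_isHomogeneous d p)
      (homogeneousComponent_mem (fun _ => hS.euler_mem) hpS d)
  obtain ⟨p, hp, hpS, hpW⟩ := Nat.find_spec hex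
  refine ⟨Nat.find hex, p, hp, hpS, hpW, fun a => ?_⟩
  rcases hd : Nat.find hex with _ | d
  · rw [conf_eq_zero_of_isHomogeneous_zero (hd ▸ hp)]
    exact W.zero_mem
  · by_contra hW
    exact Nat.find_min hex (hd ▸ Nat.lt_succ_self d)
      ⟨_, isHomogeneous_conf (hd ▸ hp) s a, hS.conf_mem a hpS, hW⟩

variable [Nontrivial σ]

lemma le_rsqMultiples (hS : ConfStable s S) (hs : ∀ d : ℕ, (d : K) + s ≠ 0) {j : ℕ}
    (hj : (Fintype.card σ : K) = 2 * (s + j)) (h1 : 1 ∉ S) : S ≤ rsqMultiples σ K j := by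
  classical
  by_contra hSW
  obtain ⟨d, p, hp, hpS, hpW, hconf⟩ := hS.exists_conf_mem hSW
  simp only [mem_rsqMultiples] at hpW hconf
  have hp0 : p ≠ 0 := fun h => hpW (h ▸ dvd_zero _)
  obtain _ | d := d
  · exact h1 (one_mem_of_isHomogeneous_zero hp hp0 hpS)
  have hds : ((d + 1 : ℕ) : K) - 1 + s ≠ 0 := by simpa using hs d
  by_cases hdj : d + 1 = 2 * j
  · obtain ⟨m, c, hm, rfl, -⟩ := exists_eq_C_mul_rsq_pow_of_conf_eq_zero hp hp0 d.succ_ne_zero hds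
      fun a => eq_zero_of_rsq_pow_dvd (isHomogeneous_conf hp s a) (by omega) (hconf a)
    exact hpW (show j = m by omega ▸ dvd_mul_left _ _)
  · cases j with
    | zero => exact hpW (pow_zero (rsq : MvPolynomial σ K) ▸ one_dvd _)
    | succ m =>
      refine hpW (rsq_pow_dvd_of_dvd_conf (euler_of_isHomogeneous hp)
        (mul_ne_zero (Nat.cast_ne_zero.2 d.succ_ne_zero) hds) (fun h => hdj ?_) fun i => hconf _)
      have : ((d + 1 : ℕ) : K) = ((2 * (m + 1) : ℕ) : K) := by
        push_cast at h hj ⊢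
        linear_combination hj - h
      exact_mod_cast this

lemma one_mem (hS : ConfStable s S) (hs : ∀ d : ℕ, (d : K) + s ≠ 0)
    (hcard : ∀ j : ℕ, 1 ≤ j → (Fintype.card σ : K) ≠ 2 * (s + j)) (h0 : S ≠ ⊥) : 1 ∈ S := by
  obtain ⟨d, p, hp, hpS, hp0, hconf⟩ := hS.exists_conf_mem (W := ⊥) (by rwa [le_bot_iff])
  obtain _ | d := d
  · exact one_mem_of_isHomogeneous_zero hp hp0 hpS
  · obtain ⟨m, c, hm, -, h⟩ := exists_eq_C_mul_rsq_pow_of_conf_eq_zero hp hp0 d.succ_ne_zero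
      (by simpa using hs d) hconf
    exact absurd h (hcard m (by omega))

end ConfStable

end StableSubspaces

section IsotropicGenerators

variable {σ K : Type*} [Field K]

/-- The infinitesimal rotation in the plane spanned by `b` and `c`. -/
def planeRotation (b c : σ → K) : Matrix σ σ K := vecMulVec b c - vecMulVec c b

lemma transpose_planeRotation (b c : σ → K) : (planeRotation b c)ᵀ = -planeRotation b c := by
  simp only [planeRotation, transpose_sub, transpose_vecMulVec, neg_sub]

variable [Fintype σ]

lemma dirDeriv_linForm_pow (a b : σ → K) (l : ℕ) :
    dirDeriv b (linForm a ^ l) = C (l * (b ⬝ᵥ a)) * linForm a ^ (l - 1) := by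
  simp only [Derivation.leibniz_pow, dirDeriv_linForm, smul_eq_mul, nsmul_eq_mul, map_mul,
    map_natCast]
  ring

lemma euler_linForm_pow (a : σ → K) (l : ℕ) :
    euler (linForm a ^ l) = C (l : K) * linForm a ^ l := by
  induction l with
  | zero => simp
  | succ l ih =>
    rw [pow_succ', euler_linForm_mul, ih, Nat.cast_succ, map_add, C_1]
    ring

lemma laplacian_linForm_pow {a : σ → K} (ha : a ⬝ᵥ a = 0) (l : ℕ) :
    laplacian (linForm a ^ l) = 0 := by
  induction l with
  | zero => simp [laplacian_apply]
  | succ l ih =>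
    rw [pow_succ', laplacian_linForm_mul, ih, dirDeriv_linForm_pow, ha]
    simp only [mul_zero, C_0, zero_mul, add_zero]

lemma linField_planeRotation (b c : σ → K) (p : MvPolynomial σ K) :
    linField (planeRotation b c) p = linForm b * dirDeriv c p - linForm c * dirDeriv b p := by
  simp only [planeRotation, map_sub, Derivation.sub_apply, linField_vecMulVec]

lemma linField_planeRotation_linForm_pow {a b c : σ → K} (hb : b ⬝ᵥ a = 0) (hc : c ⬝ᵥ a = 1)
    (l : ℕ) : linField (planeRotation b c) (linForm a ^ (l + 1)) =
      C (l + 1 : K) * (linForm b * linForm a ^ l) := by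
  rw [linField_planeRotation, dirDeriv_linForm_pow, dirDeriv_linForm_pow, hb, hc]
  simp only [mul_one, mul_zero, C_0, zero_mul, sub_zero, add_tsub_cancel_right, Nat.cast_succ]
  ring

variable {a c : σ → K}

lemma sum_linField_planeRotation_linForm_mul_pow [DecidableEq σ] (ha : a ⬝ᵥ a = 0)
    (hc : c ⬝ᵥ c = 0) (hca : c ⬝ᵥ a = 1) (l : ℕ) :
    ∑ i, linField (planeRotation (Pi.single i 1) c)
        (linForm (Pi.single i 1 - a i • c) * linForm a ^ l) =
      C (l : K) * (rsq * linForm a ^ (l - 1)) -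
        C (2 * l + Fintype.card σ - 2 : K) * (linForm c * linForm a ^ l) := by
  have hpow : (l : MvPolynomial σ K) * linForm a ^ (l - 1) * linForm a = l * linForm a ^ l := by
    cases l with
    | zero => simp only [Nat.cast_zero, zero_mul]
    | succ l => rw [mul_assoc, ← pow_succ, add_tsub_cancel_right]
  have hterm (i : σ) : linField (planeRotation (Pi.single i 1) c)
        (linForm (Pi.single i 1 - a i • c) * linForm a ^ l) =
      C (c i) * X i * linForm a ^ l +
        (l : MvPolynomial σ K) * linForm a ^ (l - 1) * (X i ^ 2 - C (a i) * X i * linForm c) -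
      linForm c * ((1 - C (a i) * C (c i)) * linForm a ^ l +
        (l : MvPolynomial σ K) * linForm a ^ (l - 1) *
          (C (a i) * X i - C (a i) * C (a i) * linForm c)) := by
    rw [linField_planeRotation, dirDeriv_linForm_mul, dirDeriv_linForm_mul, dirDeriv_linForm_pow,
      dirDeriv_linForm_pow]
    simp only [map_sub, map_smul, linForm_single, smul_eq_C_mul, dotProduct_sub, dotProduct_smul,
      hc, hca, single_one_dotProduct, dotProduct_single_one, smul_eq_mul, mul_one, mul_zero,
      sub_zero, Pi.single_eq_same, map_one, map_mul, map_natCast]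
    ring
  have hsum (b : σ → K) : ∑ i, C (a i) * C (b i) = (C (b ⬝ᵥ a) : MvPolynomial σ K) := by
    simp only [dotProduct, map_sum, map_mul, mul_comm]
  have hrsq : ∑ i, X i ^ 2 = (rsq : MvPolynomial σ K) := rfl
  rw [Finset.sum_congr rfl fun i _ => hterm i]
  simp only [Finset.sum_sub_distrib, Finset.sum_add_distrib, ← Finset.sum_mul,
    ← Finset.mul_sum, ← linForm_apply, hsum, ha, hca, Finset.sum_const, Finset.card_univ,
    nsmul_eq_mul, hrsq, map_zero, map_one, map_add, map_sub, map_mul, map_ofNat, map_natCast]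
  linear_combination -2 * linForm c * hpow

variable {S : Submodule K (MvPolynomial σ K)}

lemma RotStable.sInf {𝒮 : Set (Submodule K (MvPolynomial σ K))} (h𝒮 : ∀ S ∈ 𝒮, RotStable S) :
    RotStable (sInf 𝒮) where
  euler_mem hp := Submodule.mem_sInf.2 fun S hS =>
    (h𝒮 S hS).euler_mem (Submodule.mem_sInf.1 hp S hS)
  linField_mem hA _ hp := Submodule.mem_sInf.2 fun S hS =>
    (h𝒮 S hS).linField_mem hA (Submodule.mem_sInf.1 hp S hS)

lemma RotStable.iInf_comap_linForm (hS : RotStable S) :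
    RotStable (⨅ b, S.comap (LinearMap.mulLeft K (linForm b))) where
  euler_mem {p} hp := by
    simp only [Submodule.mem_iInf, Submodule.mem_comap, LinearMap.mulLeft_apply] at hp ⊢
    intro b
    have h : linForm b * euler p = euler (linForm b * p) - linForm b * p := by
      rw [euler_linForm_mul]
      ring
    exact h ▸ S.sub_mem (hS.euler_mem (hp b)) (hp b)
  linField_mem {A} hA p hp := by
    simp only [Submodule.mem_iInf, Submodule.mem_comap, LinearMap.mulLeft_apply] at hp ⊢
    intro b
    have h : linForm b * linField A p = linField A (linForm b * p) - linForm (A *ᵥ b) * p := by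
      rw [linField_linForm_mul]
      ring
    exact h ▸ S.sub_mem (hS.linField_mem hA (hp b)) (hp _)

lemma RotStable.iInf_comap_rsq_pow (hS : RotStable S) (j : ℕ) :
    RotStable (⨅ k, S.comap (LinearMap.mulLeft K (rsq ^ (j + k)))) where
  euler_mem {p} hp := by
    simp only [Submodule.mem_iInf, Submodule.mem_comap, LinearMap.mulLeft_apply] at hp ⊢
    intro k
    have h : rsq ^ (j + k) * euler p = euler (rsq ^ (j + k) * p) -
        C ((2 * (j + k) : ℕ) : K) * (rsq ^ (j + k) * p) := by
      rw [Derivation.leibniz, euler_of_isHomogeneous (isHomogeneous_rsq.pow (j + k)), smul_eq_mul,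
        smul_eq_mul]
      ring
    exact h ▸ S.sub_mem (hS.euler_mem (hp k)) (C_mul' (R := K) .. ▸ S.smul_mem _ (hp k))
  linField_mem {A} hA p hp := by
    simp only [Submodule.mem_iInf, Submodule.mem_comap, LinearMap.mulLeft_apply] at hp ⊢
    exact fun k => linField_rsq_pow_mul hA (j + k) p ▸ hS.linField_mem hA (hp k)

variable [CharZero K]

lemma RotStable.linForm_mul_pow_mem (hS : RotStable S) (hrsq : ∀ p ∈ S, rsq * p ∈ S)
    (hpow : ∀ l, linForm a ^ l ∈ S) (ha : a ⬝ᵥ a = 0) (hc : c ⬝ᵥ c = 0) (hca : c ⬝ᵥ a = 1)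
    (hσ : 3 ≤ Fintype.card σ) (b : σ → K) (l : ℕ) : linForm b * linForm a ^ l ∈ S := by
  classical
  have cancel {t : K} (ht : t ≠ 0) {p : MvPolynomial σ K} (hp : C t * p ∈ S) : p ∈ S := by
    rwa [← smul_eq_C_mul, S.smul_mem_iff ht] at hp
  have horth {b : σ → K} (hb : b ⬝ᵥ a = 0) (l : ℕ) : linForm b * linForm a ^ l ∈ S := by
    refine cancel (Nat.cast_add_one_ne_zero l) ?_
    rw [← linField_planeRotation_linForm_pow hb hca]
    exact hS.linField_mem (transpose_planeRotation b c) (hpow _)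
  have hproj (b : σ → K) : (b - (b ⬝ᵥ a) • c) ⬝ᵥ a = 0 := by
    rw [sub_dotProduct, smul_dotProduct, hca, smul_eq_mul, mul_one, sub_self]
  have hdual : linForm c * linForm a ^ l ∈ S := by
    have hne : (2 * l + Fintype.card σ - 2 : K) ≠ 0 := by
      have : ((2 * l + Fintype.card σ - 2 : ℕ) : K) ≠ 0 := Nat.cast_ne_zero.2 (by omega)
      rwa [Nat.cast_sub (by omega), Nat.cast_add, Nat.cast_mul] at this
    refine cancel hne ((S.sub_mem_iff_right (x := C (l : K) * (rsq * linForm a ^ (l - 1))) ?_).1 ?_)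
    · rw [← smul_eq_C_mul]
      exact S.smul_mem _ (hrsq _ (hpow _))
    · rw [← sum_linField_planeRotation_linForm_mul_pow ha hc hca]
      refine S.sum_mem fun i _ => hS.linField_mem (transpose_planeRotation _ _) (horth ?_ l)
      simpa using hproj (Pi.single i 1)
  have hb := S.add_mem (horth (hproj b) l) (S.smul_mem (b ⬝ᵥ a) hdual)
  rwa [← smul_mul_assoc, ← add_mul, ← map_smul, ← map_add, sub_add_cancel] at hb

lemma eq_top_of_linForm_pow_mem (hS : RotStable S) (hrsq : ∀ p ∈ S, rsq * p ∈ S)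
    (hpow : ∀ l, linForm a ^ l ∈ S) (ha : a ⬝ᵥ a = 0) (hc : c ⬝ᵥ c = 0) (hca : c ⬝ᵥ a = 1)
    (hσ : 3 ≤ Fintype.card σ) : S = ⊤ := by
  classical
  -- The smallest space as in the statement is closed under multiplication by linear forms.
  let 𝒮 : Set (Submodule K (MvPolynomial σ K)) :=
    {S | RotStable S ∧ (∀ p ∈ S, rsq * p ∈ S) ∧ ∀ l, linForm a ^ l ∈ S}
  have hrot : RotStable (sInf 𝒮) := RotStable.sInf fun T hT => hT.1
  have hrsq₀ : ∀ p ∈ sInf 𝒮, rsq * p ∈ sInf 𝒮 := fun p hp =>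
    Submodule.mem_sInf.2 fun T hT => hT.2.1 p (Submodule.mem_sInf.1 hp T hT)
  have hpow₀ (l : ℕ) : linForm a ^ l ∈ sInf 𝒮 := Submodule.mem_sInf.2 fun T hT => hT.2.2 l
  let T := ⨅ b, (sInf 𝒮).comap (LinearMap.mulLeft K (linForm b))
  have hT {p : MvPolynomial σ K} : p ∈ T ↔ ∀ b, linForm b * p ∈ sInf 𝒮 := by
    simp only [T, Submodule.mem_iInf, Submodule.mem_comap, LinearMap.mulLeft_apply]
  have hST : sInf 𝒮 ≤ T := sInf_le ⟨hrot.iInf_comap_linForm,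
    fun p hp => hT.2 fun b => mul_left_comm rsq (linForm b) p ▸ hrsq₀ _ (hT.1 hp b),
    fun l => hT.2 fun b => hrot.linForm_mul_pow_mem hrsq₀ hpow₀ ha hc hca hσ b l⟩
  have htop : sInf 𝒮 = ⊤ := eq_top_of_X_mul_mem
    (fun i p hp => linForm_single (R := K) i ▸ hT.1 (hST hp) _) (pow_zero (linForm a) ▸ hpow₀ 0)
  exact top_le_iff.1 (htop ▸ sInf_le ⟨hS, hrsq, hpow⟩)

lemma RotStable.rsqMultiples_le (hS : RotStable S) {j : ℕ}
    (hmem : ∀ l k, linForm a ^ l * rsq ^ (j + k) ∈ S) (ha : a ⬝ᵥ a = 0) (hc : c ⬝ᵥ c = 0)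
    (hca : c ⬝ᵥ a = 1) (hσ : 3 ≤ Fintype.card σ) : rsqMultiples σ K j ≤ S := by
  have hT {p : MvPolynomial σ K} : p ∈ ⨅ k, S.comap (LinearMap.mulLeft K (rsq ^ (j + k))) ↔
      ∀ k, rsq ^ (j + k) * p ∈ S := by
    simp only [Submodule.mem_iInf, Submodule.mem_comap, LinearMap.mulLeft_apply]
  have htop := eq_top_of_linForm_pow_mem (hS.iInf_comap_rsq_pow j)
    (fun p hp => hT.2 fun k => by
      rw [← mul_assoc, ← pow_succ]
      exact hT.1 hp (k + 1))
    (fun l => hT.2 fun k => mul_comm (linForm a ^ l) _ ▸ hmem l k) ha hc hca hσ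
  intro p hp
  obtain ⟨p, rfl⟩ := mem_rsqMultiples.1 hp
  exact hT.1 (htop ▸ Submodule.mem_top) 0

end IsotropicGenerators

section Bigrading

lemma iSupIndep_eigenspace_inf_eigenspace {K V : Type*} [Field K] [AddCommGroup V] [Module K V]
    {f g : Module.End K V} (hfg : Commute f g) :
    iSupIndep fun x : K × K => f.eigenspace x.1 ⊓ g.eigenspace x.2 := by
  have h := Module.End.independent_iInf_maxGenEigenspace_of_forall_mapsTo ![f, g] fun i j φ =>
    Module.End.mapsTo_maxGenEigenspace_of_comm (by
      fin_cases i <;> fin_cases j <;> first | exact Commute.refl _ | exact hfg | exact hfg.symm) φ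
  refine (h.comp (f := fun x : K × K => ![x.1, x.2]) fun x y hxy => ?_).mono fun x => ?_
  · exact Prod.ext (congrFun hxy 0) (congrFun hxy 1)
  · refine le_iInf (Fin.forall_fin_two.2 ⟨?_, ?_⟩)
    · exact inf_le_left.trans ((f.genEigenspace x.1).mono le_top)
    · exact inf_le_right.trans ((g.genEigenspace x.2).mono le_top)

variable {σ K : Type*} [Fintype σ] [Field K]

/-- The operator `rsq * Δ`. It commutes with the Euler operator and the rotations, and separates
the products of a power of `rsq` and a harmonic polynomial of the same degree. -/
def rsqLaplacian : Module.End K (MvPolynomial σ K) := LinearMap.mulLeft K rsq ∘ₗ laplacian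

lemma rsqLaplacian_apply (p : MvPolynomial σ K) : rsqLaplacian p = rsq * laplacian p := rfl

lemma euler_rsqLaplacian (p : MvPolynomial σ K) :
    euler (rsqLaplacian p) = rsqLaplacian (euler p) := by
  rw [rsqLaplacian_apply, rsqLaplacian_apply, euler_rsq_mul, euler_laplacian]
  ring

lemma commute_euler_rsqLaplacian :
    Commute (euler (R := K) (σ := σ) : Module.End K (MvPolynomial σ K)) rsqLaplacian :=
  LinearMap.ext euler_rsqLaplacian

/-- The eigenvalue of `rsqLaplacian` on the product of `rsq ^ k` and a harmonic polynomial of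
degree `l`. -/
def rsqLaplacianEigenvalue (σ K : Type*) [Fintype σ] [Field K] (l k : ℕ) : K :=
  2 * k * (2 * k + 2 * l + Fintype.card σ - 2)

/-- The simultaneous eigenspace of the Euler operator and `rsqLaplacian` which contains the
products of `rsq ^ k` and a harmonic polynomial of degree `l`. -/
def bigradedPart (σ K : Type*) [Fintype σ] [Field K] (l k : ℕ) :
    Submodule K (MvPolynomial σ K) :=
  Module.End.eigenspace euler.toLinearMap ((l + 2 * k : ℕ) : K) ⊓
    Module.End.eigenspace rsqLaplacian (rsqLaplacianEigenvalue σ K l k)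

lemma mem_bigradedPart {l k : ℕ} {p : MvPolynomial σ K} : p ∈ bigradedPart σ K l k ↔
    euler p = C ((l + 2 * k : ℕ) : K) * p ∧
      rsq * laplacian p = C (rsqLaplacianEigenvalue σ K l k) * p := by
  simp only [bigradedPart, Submodule.mem_inf, Module.End.mem_eigenspace_iff, Derivation.coeFn_coe,
    rsqLaplacian_apply, smul_eq_C_mul]

lemma rotStable_bigradedPart (l k : ℕ) : RotStable (bigradedPart σ K l k) where
  euler_mem {p} hp := by
    rw [(mem_bigradedPart.1 hp).1, ← smul_eq_C_mul]
    exact Submodule.smul_mem _ _ hp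
  linField_mem {A} hA p hp := by
    obtain ⟨h₁, h₂⟩ := mem_bigradedPart.1 hp
    refine mem_bigradedPart.2 ⟨?_, ?_⟩
    · rw [← linField_euler, h₁, derivation_map_C_mul]
    · have h := linField_rsq_pow_mul hA 1 (laplacian p)
      rw [pow_one] at h
      rw [← linField_laplacian hA, ← h, h₂, derivation_map_C_mul]

lemma rsq_pow_mul_mem_bigradedPart {l : ℕ} {p : MvPolynomial σ K} (hp : euler p = C (l : K) * p)
    (hharm : laplacian p = 0) (k : ℕ) : rsq ^ k * p ∈ bigradedPart σ K l k := by
  rw [mem_bigradedPart]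
  induction k with
  | zero => simp [hp, hharm, rsqLaplacianEigenvalue]
  | succ k ih =>
    obtain ⟨h₁, h₂⟩ := ih
    rw [pow_succ', mul_assoc, euler_rsq_mul, laplacian_rsq_mul, h₁, h₂]
    simp only [rsqLaplacianEigenvalue, map_add, map_mul, map_sub, map_natCast, map_ofNat,
      map_one, Nat.cast_add, Nat.cast_mul, Nat.cast_ofNat, Nat.cast_one]
    constructor <;> ring

variable [CharZero K]

lemma rsqLaplacianEigenvalue_injective (hσ : 3 ≤ Fintype.card σ) :
    Function.Injective fun x : ℕ × ℕ =>
      (((x.1 + 2 * x.2 : ℕ) : K), rsqLaplacianEigenvalue σ K x.1 x.2) := by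
  rintro ⟨l, k⟩ ⟨l', k'⟩ h
  obtain ⟨h₁, h₂⟩ := Prod.ext_iff.1 h
  have hd : l + 2 * k = l' + 2 * k' := Nat.cast_injective h₁
  simp only [rsqLaplacianEigenvalue, Nat.cast_add, Nat.cast_mul, Nat.cast_ofNat] at h₁ h₂
  have hprod : ((k : K) - k') * (l + l' + Fintype.card σ - 2) = 0 := by
    linear_combination h₂ / 2 - (k + k') * h₁
  have hne : ((l : K) + l' + Fintype.card σ - 2) ≠ 0 := by
    have : ((l + l' + Fintype.card σ - 2 : ℕ) : K) ≠ 0 := Nat.cast_ne_zero.2 (by omega)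
    rwa [Nat.cast_sub (by omega), Nat.cast_add, Nat.cast_add] at this
  have hk : k = k' := Nat.cast_injective (sub_eq_zero.1 ((mul_eq_zero.1 hprod).resolve_right hne))
  exact Prod.ext (by dsimp only; omega) hk

lemma iSupIndep_bigradedPart (hσ : 3 ≤ Fintype.card σ) :
    iSupIndep fun x : ℕ × ℕ => bigradedPart σ K x.1 x.2 := by
  have h := iSupIndep_eigenspace_inf_eigenspace (commute_euler_rsqLaplacian (K := K) (σ := σ))
  exact (h.comp (rsqLaplacianEigenvalue_injective hσ) :)

end Bigrading

end PolyOp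

end

noncomputable section

lemma isCoatom_of_isGreatest_ne_top {α : Type*} [PartialOrder α] [OrderTop α] {a : α}
    (h : IsGreatest {x | x ≠ ⊤} a) : IsCoatom a :=
  ⟨h.1, fun _ hb => by_contra fun hne => hb.not_ge (h.2 hne)⟩

lemma isCompl_iSup_of_isCompl_range {α ι κ κ' : Type*} [CompleteLattice α] [IsModularLattice α]
    [IsCompactlyGenerated α] {t : ι → α} (hind : iSupIndep t) (htop : ⨆ i, t i = ⊤) {f : κ → ι}
    {g : κ' → ι} (hfg : IsCompl (Set.range f) (Set.range g)) :
    IsCompl (⨆ k, t (f k)) (⨆ k, t (g k)) := by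
  rw [← iSup_range (g := t), ← iSup_range (g := t)]
  refine ⟨hind.disjoint_biSup_biSup hfg.disjoint, codisjoint_iff.2 ?_⟩
  have h : Set.range f ∪ Set.range g = Set.univ := hfg.sup_eq_top
  rw [← iSup_union, h, iSup_univ, htop]

lemma isCompl_range_lt_range_add (j : ℕ) :
    IsCompl (Set.range fun p : ℕ × Fin j => (p.1, (p.2 : ℕ)))
      (Set.range fun p : ℕ × ℕ => (p.1, j + p.2)) := by
  refine eq_compl_iff_isCompl.1 (Set.ext fun ⟨l, k⟩ => ?_)
  simp only [Set.mem_range, Set.mem_compl_iff, Prod.exists, Prod.mk.injEq]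
  refine ⟨?_, fun h => ?_⟩
  · rintro ⟨_, b, -, rfl⟩ ⟨_, c, -, h⟩
    exact absurd b.2 (by omega)
  · exact ⟨l, ⟨k, by_contra fun hk => h ⟨l, k - j, rfl, by omega⟩⟩, rfl, rfl⟩

section DirectSum

variable {B M ι : Type*} [Ring B] [AddCommGroup M] [Module B M] [DecidableEq ι]
  {T : ι → Submodule B M} {W : Submodule B M}

/-- The direct sum of an independent family of submodules, as the quotient by a complement. -/
def directSumEquivQuotient (hT : iSupIndep T) (hTW : IsCompl (⨆ i, T i) W) :
    (⨁ i, T i) ≃ₗ[B] M ⧸ W :=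
  LinearEquiv.ofInjective (DirectSum.coeLinearMap T) hT.dfinsupp_lsum_injective ≪≫ₗ
    (Submodule.quotientEquivOfIsCompl W _ (DirectSum.range_coeLinearMap (A := T) ▸ hTW).symm).symm

lemma directSumEquivQuotient_lof (hT : iSupIndep T) (hTW : IsCompl (⨆ i, T i) W) (i : ι)
    (x : T i) : directSumEquivQuotient hT hTW (DirectSum.lof B ι (fun i => T i) i x) =
      Submodule.Quotient.mk (x : M) := by
  rw [directSumEquivQuotient, LinearEquiv.trans_apply, Submodule.quotientEquivOfIsCompl_symm_apply]
  exact congrArg Submodule.Quotient.mk (DirectSum.coeLinearMap_lof T i x)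

end DirectSum

end

noncomputable section

attribute [local instance 100] LieRing.ofAssociativeRing

namespace SO2n

open Complex Matrix PolyOp

/-- The component in `ℂⁿ` of `A e₁`; its kernel is the parabolic `q`. -/
def lowerPart (n : ℕ) : G n →ₗ[ℂ] Fin n → ℂ where
  toFun A i := A.1 (Sum.inr i) (Sum.inl 0) + I * A.1 (Sum.inr i) (Sum.inl 1)
  map_add' A B := by ext i; simp; ring
  map_smul' c A := by ext i; simp; ring

/-- The component in `ℂⁿ` of `A e₋₁`, i.e. the `p⁺`-coordinates of `A`. -/
def upperPart (n : ℕ) : G n →ₗ[ℂ] Fin n → ℂ where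
  toFun A i := 1 / 2 * (A.1 (Sum.inr i) (Sum.inl 0) - I * A.1 (Sum.inr i) (Sum.inl 1))
  map_add' A B := by ext i; simp; ring
  map_smul' c A := by ext i; simp; ring

/-- The `so(n)`-block of `A`. -/
def rotPart (n : ℕ) : G n →ₗ[ℂ] Matrix (Fin n) (Fin n) ℂ where
  toFun A := A.1.toBlocks₂₂
  map_add' _ _ := rfl
  map_smul' _ _ := rfl

variable {n : ℕ}

lemma lowerPart_apply (A : G n) (i : Fin n) :
    lowerPart n A i = A.1 (Sum.inr i) (Sum.inl 0) + I * A.1 (Sum.inr i) (Sum.inl 1) := rfl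

lemma upperPart_apply (A : G n) (i : Fin n) :
    upperPart n A i =
      1 / 2 * (A.1 (Sum.inr i) (Sum.inl 0) - I * A.1 (Sum.inr i) (Sum.inl 1)) := rfl

lemma rotPart_apply (A : G n) (i j : Fin n) :
    rotPart n A i j = A.1 (Sum.inr i) (Sum.inr j) := rfl

lemma entry_symm (A : G n) (p q : Fin 2 ⊕ Fin n) :
    A.1 q p * Sum.elim (fun _ => 1) (fun _ => -1) q =
      -(Sum.elim (fun _ => 1) (fun _ => -1) p * A.1 p q) := by
  have h := congrFun (congrFun ((mem_so' A.1).1 A.2) p) q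
  simpa [eta, LieAlgebra.Orthogonal.indefiniteDiagonal, Matrix.mul_diagonal,
        Matrix.diagonal_mul] using h

lemma entry_inl_inr (A : G n) (a : Fin 2) (i : Fin n) :
    A.1 (Sum.inl a) (Sum.inr i) = A.1 (Sum.inr i) (Sum.inl a) := by
  simpa using (entry_symm A (Sum.inl a) (Sum.inr i)).symm

lemma entry_inl_self (A : G n) (a : Fin 2) : A.1 (Sum.inl a) (Sum.inl a) = 0 := by
  simpa [self_eq_neg] using entry_symm A (Sum.inl a) (Sum.inl a)

lemma entry_one_zero (A : G n) :
    A.1 (Sum.inl 1) (Sum.inl 0) = -A.1 (Sum.inl 0) (Sum.inl 1) := by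
  simpa using entry_symm A (Sum.inl 0) (Sum.inl 1)

lemma rotPart_transpose (A : G n) : (rotPart n A)ᵀ = -rotPart n A := by
  ext i j
  have h : A.1 (Sum.inr j) (Sum.inr i) = -A.1 (Sum.inr i) (Sum.inr j) := by
    simpa [neg_eq_iff_eq_neg] using entry_symm A (Sum.inr i) (Sum.inr j)
  simp only [transpose_apply, Matrix.neg_apply, rotPart_apply, h]

lemma weight₁_apply (A : G n) : weight₁ n A = I * A.1 (Sum.inl 0) (Sum.inl 1) := by
  change (A.1 *ᵥ e n 1) (Sum.inl 0) = _
  rw [e_one]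
  simp [Matrix.mulVec, dotProduct, entry_inl_self, mul_comm]

lemma ext_parts {A B : G n} (hlower : lowerPart n A = lowerPart n B)
    (hupper : upperPart n A = upperPart n B) (hweight : weight₁ n A = weight₁ n B)
    (hrot : rotPart n A = rotPart n B) : A = B := by
  have hl (i) := congrFun hlower i
  have hu (i) := congrFun hupper i
  simp only [lowerPart_apply, upperPart_apply] at hl hu
  have h0 (i) : A.1 (Sum.inr i) (Sum.inl 0) = B.1 (Sum.inr i) (Sum.inl 0) := by
    linear_combination (hl i) / 2 + hu i
  have h1 (i) : A.1 (Sum.inr i) (Sum.inl 1) = B.1 (Sum.inr i) (Sum.inl 1) :=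
    mul_left_cancel₀ I_ne_zero (by linear_combination (hl i) / 2 - hu i)
  have h01 : A.1 (Sum.inl 0) (Sum.inl 1) = B.1 (Sum.inl 0) (Sum.inl 1) :=
    mul_left_cancel₀ I_ne_zero (by rwa [weight₁_apply, weight₁_apply] at hweight)
  refine Subtype.ext (Matrix.ext ?_)
  rintro (a | i) (b | j)
  · fin_cases a <;> fin_cases b <;> simp [entry_inl_self, entry_one_zero, h01]
  · fin_cases a <;> simp [entry_inl_inr, h0, h1]
  · fin_cases b <;> simp [h0, h1]
  · exact congrFun (congrFun hrot i) j

lemma mem_k_iff {A : G n} : A ∈ k n ↔ lowerPart n A = 0 ∧ upperPart n A = 0 := by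
  refine ⟨fun hA => ⟨?_, ?_⟩, fun ⟨hlower, hupper⟩ a i => ?_⟩
  · ext i; simp [lowerPart_apply, (hA 0 i).2, (hA 1 i).2]
  · ext i; simp [upperPart_apply, (hA 0 i).2, (hA 1 i).2]
  · have hl : lowerPart n A i = 0 := congrFun hlower i
    have hu : upperPart n A i = 0 := congrFun hupper i
    rw [lowerPart_apply] at hl
    rw [upperPart_apply] at hu
    have h0 : A.1 (Sum.inr i) (Sum.inl 0) = 0 := by linear_combination hl / 2 + hu
    have h1 : A.1 (Sum.inr i) (Sum.inl 1) = 0 :=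
      mul_left_cancel₀ I_ne_zero (by linear_combination hl / 2 - hu)
    rw [entry_inl_inr]
    fin_cases a <;> simp [h0, h1]

section Bracket

variable (A B : G n)

lemma coe_lie_apply (p q : Fin 2 ⊕ Fin n) :
    (⁅A, B⁆ : G n).1 p q = (A.1 * B.1) p q - (B.1 * A.1) p q := by
  rw [LieSubalgebra.coe_bracket, Ring.lie_def, Matrix.sub_apply]

lemma weight₁_lie : weight₁ n ⁅A, B⁆ =
    upperPart n A ⬝ᵥ lowerPart n B - upperPart n B ⬝ᵥ lowerPart n A := by
  simp only [weight₁_apply, coe_lie_apply, mul_apply, Fintype.sum_sum_type, Fin.sum_univ_two,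
    entry_inl_self, entry_inl_inr, dotProduct, upperPart_apply, lowerPart_apply, mul_sub, mul_add,
    Finset.mul_sum]
  simp only [add_sub_add_comm, ← Finset.sum_sub_distrib]
  rw [← sub_eq_zero, add_sub_assoc, ← Finset.sum_sub_distrib, Finset.sum_eq_zero]
  · ring
  · intro i _
    ring

lemma lowerPart_lie : lowerPart n ⁅A, B⁆ =
    weight₁ n B • lowerPart n A - weight₁ n A • lowerPart n B +
      rotPart n A *ᵥ lowerPart n B - rotPart n B *ᵥ lowerPart n A := by
  ext i
  simp only [weight₁_apply, coe_lie_apply, mul_apply, Fintype.sum_sum_type, Fin.sum_univ_two,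
    entry_inl_self, entry_one_zero, lowerPart_apply, rotPart_apply, mulVec, dotProduct,
    Pi.add_apply, Pi.sub_apply, Pi.smul_apply, smul_eq_mul, mul_add, Finset.sum_add_distrib]
  simp only [mul_left_comm _ I, ← Finset.mul_sum]
  linear_combination -(A.1 (Sum.inr i) (Sum.inl 1) * B.1 (Sum.inl 0) (Sum.inl 1) -
    B.1 (Sum.inr i) (Sum.inl 1) * A.1 (Sum.inl 0) (Sum.inl 1)) * I_sq

lemma upperPart_lie : upperPart n ⁅A, B⁆ =
    weight₁ n A • upperPart n B - weight₁ n B • upperPart n A +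
      rotPart n A *ᵥ upperPart n B - rotPart n B *ᵥ upperPart n A := by
  ext i
  simp only [weight₁_apply, coe_lie_apply, mul_apply, Fintype.sum_sum_type, Fin.sum_univ_two,
    entry_inl_self, entry_one_zero, upperPart_apply, rotPart_apply, mulVec, dotProduct,
    Pi.add_apply, Pi.sub_apply, Pi.smul_apply, smul_eq_mul]
  have h (a x y : Fin n → ℂ) : ∑ j, a j * (1 / 2 * (x j - I * y j)) =
      1 / 2 * (∑ j, a j * x j - I * ∑ j, a j * y j) := by
    rw [Finset.mul_sum, ← Finset.sum_sub_distrib, Finset.mul_sum]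
    exact Finset.sum_congr rfl fun _ _ => by ring
  simp only [h]
  linear_combination (A.1 (Sum.inr i) (Sum.inl 1) * B.1 (Sum.inl 0) (Sum.inl 1) -
    B.1 (Sum.inr i) (Sum.inl 1) * A.1 (Sum.inl 0) (Sum.inl 1)) * (-I_sq / 2)

lemma rotPart_lie : rotPart n ⁅A, B⁆ =
    rotPart n A * rotPart n B - rotPart n B * rotPart n A +
      vecMulVec (upperPart n A) (lowerPart n B) - vecMulVec (lowerPart n B) (upperPart n A) +
      vecMulVec (lowerPart n A) (upperPart n B) - vecMulVec (upperPart n B) (lowerPart n A) := by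
  ext i j
  simp only [coe_lie_apply, mul_apply, Fintype.sum_sum_type, Fin.sum_univ_two, entry_inl_inr,
    upperPart_apply, lowerPart_apply, rotPart_apply, Matrix.add_apply, Matrix.sub_apply,
    vecMulVec_apply]
  linear_combination (A.1 (Sum.inr i) (Sum.inl 1) * B.1 (Sum.inr j) (Sum.inl 1) -
    B.1 (Sum.inr i) (Sum.inl 1) * A.1 (Sum.inr j) (Sum.inl 1)) * I_sq

end Bracket

/-- The polynomial model of `N(λ)`: the representation of `so(2,n)` on `ℂ[x₁,…,xₙ]` in which `p⁻`
acts by multiplication with linear forms, `p⁺` by conformal operators, `so(n)` by linear vector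
fields, and the constant `1` is a highest weight vector of weight `-E₀`. -/
def rep (n : ℕ) (E₀ : ℝ) : G n →ₗ⁅ℂ⁆ Module.End ℂ (MvPolynomial (Fin n) ℂ) where
  toLinearMap := LinearMap.mk₂ ℂ
    (fun A p => linForm (lowerPart n A) * p + conf (E₀ : ℂ) (upperPart n A) p -
      MvPolynomial.C (weight₁ n A) * (euler p + MvPolynomial.C (E₀ : ℂ) * p) +
      linField (rotPart n A) p)
    (fun A B p => by simp only [map_add, LinearMap.add_apply, Derivation.add_apply]; ring)
    (fun c A p => by
      simp only [map_smul, LinearMap.smul_apply, Derivation.smul_apply,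
        MvPolynomial.smul_eq_C_mul, smul_eq_mul, map_mul]
      ring)
    (fun A p q => by simp only [map_add]; ring)
    (fun c A p => by
      simp only [MvPolynomial.smul_eq_C_mul, linearMap_map_C_mul, derivation_map_C_mul]; ring)
  map_lie' := fun {A B} => LinearMap.ext fun p => by
    have hrot := linField_commutator (rotPart n A) (rotPart n B) p
    rw [map_sub, Derivation.sub_apply] at hrot
    simp only [AddHom.toFun_eq_coe, LinearMap.coe_toAddHom, LinearMap.mk₂_apply, Ring.lie_def,
      LinearMap.sub_apply, Module.End.mul_apply, weight₁_lie, lowerPart_lie, upperPart_lie,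
      rotPart_lie, map_add, map_sub, map_smul, LinearMap.add_apply, LinearMap.smul_apply,
      Derivation.add_apply, Derivation.sub_apply, linField_vecMulVec, linearMap_map_C_mul,
      derivation_map_C_mul, linField_linForm_mul, euler_linForm_mul, conf_linForm_mul, euler_conf,
      linField_conf (rotPart_transpose _), linField_euler, MvPolynomial.smul_eq_C_mul]
    rw [conf_comm _ (upperPart n A) (upperPart n B)]
    linear_combination -hrot

lemma rep_apply (E₀ : ℝ) (A : G n) (p : MvPolynomial (Fin n) ℂ) :
    rep n E₀ A p = linForm (lowerPart n A) * p + conf (E₀ : ℂ) (upperPart n A) p -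
      MvPolynomial.C (weight₁ n A) * (euler p + MvPolynomial.C (E₀ : ℂ) * p) +
      linField (rotPart n A) p := rfl

lemma wedge_apply (u w : Fin 2 ⊕ Fin n → ℂ) (p q : Fin 2 ⊕ Fin n) :
    (wedge u w).1 p q = (w p * u q - u p * w q) * Sum.elim (fun _ => 1) (fun _ => -1) q := by
  simp only [wedge, wedgeMatrix, eta, LieAlgebra.Orthogonal.indefiniteDiagonal, Matrix.sub_apply,
    vecMulVec_apply, vecMul_diagonal]
  ring

/-- The element `x ∧ a` of `so(2,n)`, for `x ∈ ℂ²` and `a ∈ ℂⁿ`; these span `p⁺ ⊕ p⁻`. -/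
def mixed (x : Fin 2 → ℂ) : (Fin n → ℂ) →ₗ[ℂ] G n where
  toFun a := wedge (Sum.elim x 0) (Sum.elim 0 a)
  map_add' a b := by
    refine Subtype.ext (Matrix.ext ?_)
    rintro (p | p) (q | q) <;> simp [wedge_apply] <;> ring
  map_smul' c a := by
    refine Subtype.ext (Matrix.ext ?_)
    rintro (p | p) (q | q) <;> simp [wedge_apply] <;> ring

section Mixed

variable (x : Fin 2 → ℂ) (a : Fin n → ℂ)

lemma mixed_apply : mixed x a = wedge (Sum.elim x 0) (Sum.elim 0 a) := rfl

lemma lowerPart_mixed : lowerPart n (mixed x a) = (x 0 + I * x 1) • a := by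
  ext i
  simp only [lowerPart_apply, mixed_apply, wedge_apply, Sum.elim_inl, Sum.elim_inr, Pi.zero_apply,
    Pi.smul_apply, smul_eq_mul]
  ring

lemma upperPart_mixed : upperPart n (mixed x a) = (1 / 2 * (x 0 - I * x 1)) • a := by
  ext i
  simp only [upperPart_apply, mixed_apply, wedge_apply, Sum.elim_inl, Sum.elim_inr, Pi.zero_apply,
    Pi.smul_apply, smul_eq_mul]
  ring

lemma weight₁_mixed : weight₁ n (mixed x a) = 0 := by
  simp [mixed_apply, weight₁_apply, wedge_apply]

lemma rotPart_mixed : rotPart n (mixed x a) = 0 := by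
  ext i j
  simp [mixed_apply, rotPart_apply, wedge_apply]

end Mixed

lemma e_neg_one (n : ℕ) : e n (-1) = Sum.elim ![1 / 2, -I / 2] 0 := by
  ext (i | i)
  · fin_cases i
    · simp [e, f]
    · simp [e, f, div_eq_mul_inv, mul_comm]
  · have h1 : ¬ (-1 : ℤ) = (i : ℤ) + 1 := by omega
    have h2 : ¬ (0 : ℤ) = (i : ℤ) + 1 := by omega
    simp [e, f, h1, h2]

/-- The parametrization `a ↦ e₋₁ ∧ a` of `p⁻` by `ℂⁿ`. -/
def lowering (n : ℕ) : (Fin n → ℂ) →ₗ[ℂ] G n := mixed ![1 / 2, -I / 2]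

/-- The parametrization `a ↦ e₁ ∧ a` of `p⁺` by `ℂⁿ`. -/
def raising (n : ℕ) : (Fin n → ℂ) →ₗ[ℂ] G n := mixed ![1, I]

section LoweringRaising

variable (a : Fin n → ℂ)

lemma lowerPart_lowering : lowerPart n (lowering n a) = a := by
  have h : (2⁻¹ + I * (-I / 2) : ℂ) = 1 := by linear_combination -I_sq / 2
  simp [lowering, lowerPart_mixed, h]

lemma upperPart_lowering : upperPart n (lowering n a) = 0 := by
  have h : (2⁻¹ - I * (-I / 2) : ℂ) = 0 := by linear_combination I_sq / 2
  simp [lowering, upperPart_mixed, h]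

lemma weight₁_lowering : weight₁ n (lowering n a) = 0 := weight₁_mixed ..

lemma rotPart_lowering : rotPart n (lowering n a) = 0 := rotPart_mixed ..

lemma lowerPart_raising : lowerPart n (raising n a) = 0 := by
  simp [raising, lowerPart_mixed]

lemma upperPart_raising : upperPart n (raising n a) = a := by
  have h : (1 / 2 * (1 - I * I) : ℂ) = 1 := by rw [I_mul_I]; norm_num
  simp only [raising, upperPart_mixed, cons_val_zero, cons_val_one, h, one_smul]

lemma weight₁_raising : weight₁ n (raising n a) = 0 := weight₁_mixed ..

lemma rotPart_raising : rotPart n (raising n a) = 0 := rotPart_mixed ..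

end LoweringRaising

/-- The component of `e_j` in `ℂⁿ`. -/
def eVec (n : ℕ) (j : ℤ) : Fin n → ℂ := fun i => e n j (Sum.inr i)

/-- The component of `f_a` in `ℂⁿ`. -/
def fVec (n : ℕ) (a : ℤ) : Fin n → ℂ := fun i => f n a (Sum.inr i)

lemma fVec_succ (m : Fin n) : fVec n ((m : ℕ) + 1) = Pi.single m 1 := by
  ext i
  simp [fVec, f, Pi.single_apply, Fin.ext_iff, eq_comm]

lemma f_inl {a : ℤ} (ha : 1 ≤ a) (i : Fin 2) : f n a (Sum.inl i) = 0 := by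
  have : ¬ a = (i : ℤ) - 1 := by omega
  simp [f, this]

lemma e_eq_elim (hn : 1 ≤ n) {j : ℤ} (hj : |j| ≠ 1) :
    e n j = Sum.elim (0 : Fin 2 → ℂ) (eVec n j) := by
  ext (i | i)
  · simp only [Sum.elim_inl, Pi.zero_apply, e]
    split_ifs with h0 hpos hneg
    · simp [f_inl (show (1 : ℤ) ≤ n by omega)]
    · simp [f_inl (show 1 ≤ 2 * j - 3 by grind), f_inl (show 1 ≤ 2 * j - 2 by grind)]
    · exact absurd (by simp [hneg]) hj
    · rw [Pi.smul_apply, Pi.sub_apply, Pi.smul_apply, f_inl (show 1 ≤ -2 * j - 3 by grind),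
        f_inl (show 1 ≤ -2 * j - 2 by grind), smul_zero, sub_zero, smul_zero]
  · rfl

lemma eVec_zero : eVec n 0 = I • fVec n n := by
  ext i; simp [eVec, e, fVec]

lemma eVec_pos {j : ℤ} (hj : 2 ≤ j) :
    eVec n j = fVec n (2 * j - 3) + I • fVec n (2 * j - 2) := by
  ext i
  simp [eVec, e, fVec, show j ≠ 0 by omega, show 0 < j by omega]

lemma eVec_neg {j : ℤ} (hj : 2 ≤ j) :
    eVec n (-j) = (-(1 / 2) : ℂ) • (fVec n (2 * j - 3) - I • fVec n (2 * j - 2)) := by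
  ext i
  simp [eVec, e, fVec, show j ≠ 0 by omega, show ¬ j < 0 by omega, show j ≠ 1 by omega]

lemma X_neg_one (hn : 1 ≤ n) {j : ℤ} (hj : |j| ≠ 1) : X n (-1) j = lowering n (eVec n j) := by
  rw [X, lowering, mixed_apply, ← e_eq_elim hn hj, e_neg_one]

lemma X_one (hn : 1 ≤ n) {j : ℤ} (hj : |j| ≠ 1) : X n 1 j = raising n (eVec n j) := by
  rw [X, raising, mixed_apply, ← e_eq_elim hn hj, e_one]

section Sums

variable {M : Type*} [AddCommMonoid M]

lemma sum_Icc_neg (T : ℤ → M) (r : ℕ) :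
    ∑ h ∈ Finset.Icc (-(r : ℤ)) r, T h =
      T 0 + ∑ j ∈ Finset.range r, (T (j + 1) + T (-(j + 1))) := by
  induction r with
  | zero => simp
  | succ r ih =>
    have : Finset.Icc (-((r + 1 : ℕ) : ℤ)) (r + 1 : ℕ) =
        insert ((r : ℤ) + 1) (insert (-((r : ℤ) + 1)) (Finset.Icc (-(r : ℤ)) r)) := by
      ext h
      simp only [Finset.mem_Icc, Finset.mem_insert]
      omega
    rw [this, Finset.sum_insert, Finset.sum_insert, ih, Finset.sum_range_succ]
    · abel
    · simp
    · simp only [Finset.mem_insert, Finset.mem_Icc, not_or]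
      omega

lemma sum_range_eq_sum_pairs (g : ℕ → M) (n : ℕ) :
    ∑ i ∈ Finset.range n, g i = (if Odd n then g (n - 1) else 0) +
      ∑ j ∈ Finset.range (n / 2), (g (2 * j) + g (2 * j + 1)) := by
  have hpairs (s : ℕ) : ∑ j ∈ Finset.range s, (g (2 * j) + g (2 * j + 1)) =
      ∑ i ∈ Finset.range (2 * s), g i := by
    induction s with
    | zero => rfl
    | succ s ih => rw [mul_add_one, Finset.sum_range_succ, ih, Finset.sum_range_succ,
        Finset.sum_range_succ, add_assoc]
  rw [hpairs]
  split_ifs with hodd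
  · rw [← Nat.two_mul_div_two_add_one_of_odd hodd, Finset.sum_range_succ, add_comm]
    grind
  · rw [Nat.two_mul_div_two_of_even (Nat.not_odd_iff_even.1 hodd), zero_add]

lemma sum_idx_abs_ne_one (T : ℤ → M) (n : ℕ) :
    ∑ h ∈ (idx n).filter (fun h => |h| ≠ 1), T h = (if Odd n then T 0 else 0) +
      ∑ j ∈ Finset.range (n / 2), (T (j + 2) + T (-(j + 2))) := by
  rw [idx, Finset.filter_filter, Finset.sum_filter, sum_Icc_neg,
    show rk n = n / 2 + 1 by simp only [rk]; omega, Finset.sum_range_succ']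
  have hterm (j : ℕ) : ((j + 1 : ℕ) : ℤ) + 1 = j + 2 := by push_cast; ring
  have hmem (j : ℕ) : ((j : ℤ) + 2 ≠ 0 ∨ Odd n) ∧ |(j : ℤ) + 2| ≠ 1 := ⟨by omega, by grind⟩
  simp only [hterm, neg_ne_zero, abs_neg, if_pos (hmem _)]
  simp

end Sums

/-- The bases `e_h` and `e_{-h}`, `|h| ≠ 1`, of `ℂⁿ` are dual for the form `-∑ xᵢ yᵢ`. -/
lemma sum_vecMulVec_eVec : ∑ h ∈ (idx n).filter (fun h => |h| ≠ 1),
    vecMulVec (eVec n h) (eVec n (-h)) = -1 := by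
  have hone : (1 : Matrix (Fin n) (Fin n) ℂ) =
      ∑ i ∈ Finset.range n, vecMulVec (fVec n (i + 1)) (fVec n (i + 1)) := by
    ext i j
    simp [Finset.sum_range, fVec_succ, Matrix.sum_apply, vecMulVec_apply, Pi.single_apply,
      one_apply]
  have hzero : vecMulVec (eVec n 0) (eVec n (-0)) = -vecMulVec (fVec n n) (fVec n n) := by
    ext i j
    simp only [neg_zero, eVec_zero, vecMulVec_apply, Pi.smul_apply, smul_eq_mul, Matrix.neg_apply]
    linear_combination (fVec n n i * fVec n n j) * I_sq
  have hpair (j : ℕ) : vecMulVec (eVec n (j + 2)) (eVec n (-(j + 2))) +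
      vecMulVec (eVec n (-(j + 2))) (eVec n (-(-(j + 2)))) =
      -(vecMulVec (fVec n ((2 * j : ℕ) + 1)) (fVec n ((2 * j : ℕ) + 1)) +
        vecMulVec (fVec n ((2 * j + 1 : ℕ) + 1)) (fVec n ((2 * j + 1 : ℕ) + 1))) := by
    rw [neg_neg, eVec_pos (by omega), eVec_neg (by omega),
      show 2 * ((j : ℤ) + 2) - 3 = (2 * j : ℕ) + 1 by push_cast; ring,
      show 2 * ((j : ℤ) + 2) - 2 = (2 * j + 1 : ℕ) + 1 by push_cast; ring]
    ext i k
    simp only [vecMulVec_apply, Matrix.add_apply, Matrix.neg_apply, Pi.add_apply, Pi.sub_apply,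
      Pi.smul_apply, smul_eq_mul]
    linear_combination (fVec n ((2 * j + 1 : ℕ) + 1) i * fVec n ((2 * j + 1 : ℕ) + 1) k) * I_sq
  rw [sum_idx_abs_ne_one, hone, sum_range_eq_sum_pairs _ n, neg_add, ← Finset.sum_neg_distrib]
  simp only [hpair, hzero]
  congr 1
  split_ifs with hodd
  · rw [Nat.cast_sub hodd.pos, Nat.cast_one, sub_add_cancel]
  · rw [neg_zero]

lemma sum_dotProduct_smul_eVec (a : Fin n → ℂ) :
    ∑ h ∈ (idx n).filter (fun h => |h| ≠ 1), (eVec n (-h) ⬝ᵥ a) • eVec n h = -a := by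
  rw [← one_mulVec a, ← neg_mulVec, ← sum_vecMulVec_eVec, sum_mulVec]
  simp [vecMulVec_mulVec]

lemma sum_linForm_eVec_mul : ∑ h ∈ (idx n).filter (fun h => |h| ≠ 1),
    linForm (eVec n h) * linForm (eVec n (-h)) = -(rsq : MvPolynomial (Fin n) ℂ) := by
  have hone : linField (1 : Matrix (Fin n) (Fin n) ℂ) = euler :=
    MvPolynomial.derivation_ext fun i => by
      rw [linField_X, euler_X, ← linForm_single]
      congr 1
      ext j
      simp [one_apply, Pi.single_apply]
  have h : linField (∑ h ∈ (idx n).filter (fun h => |h| ≠ 1),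
      vecMulVec (eVec n h) (eVec n (-h))) (rsq : MvPolynomial (Fin n) ℂ) = -(2 * rsq) := by
    rw [sum_vecMulVec_eVec, map_neg, hone, Derivation.neg_apply, euler_rsq]
  rw [map_sum, ← Derivation.coeFnAddMonoidHom_apply, map_sum, Finset.sum_apply] at h
  simp only [Derivation.coeFnAddMonoidHom_apply, linField_vecMulVec, dirDeriv_rsq] at h
  refine mul_left_cancel₀ (two_ne_zero (α := MvPolynomial (Fin n) ℂ)) ?_
  rw [mul_neg, ← h, Finset.mul_sum]
  exact Finset.sum_congr rfl fun _ _ => by ring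

lemma raising_mem_pPlus (hn : 1 ≤ n) (a : Fin n → ℂ) : raising n a ∈ pPlus n := by
  rw [← neg_neg (raising n a), ← map_neg, ← sum_dotProduct_smul_eVec, map_sum]
  refine neg_mem (Submodule.sum_mem _ fun h hh => ?_)
  obtain ⟨hidx, habs⟩ := Finset.mem_filter.1 hh
  rw [map_smul, ← X_one hn habs]
  exact Submodule.smul_mem _ _ (Submodule.subset_span ⟨h, hidx, habs, rfl⟩)

lemma mem_q_iff (hn : 1 ≤ n) {A : G n} : A ∈ q n ↔ lowerPart n A = 0 := by
  constructor
  · intro hA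
    ext i
    have h := congrFun (q_mulVec n A hA) (Sum.inr i)
    rw [e_one] at h
    simpa [mulVec, dotProduct, lowerPart_apply, mul_comm] using h
  · intro hA
    have hraising : raising n (upperPart n A) ∈ q n :=
      LieSubalgebra.subset_lieSpan (Or.inr (raising_mem_pPlus hn _))
    have hk : A - raising n (upperPart n A) ∈ q n := by
      refine LieSubalgebra.subset_lieSpan (Or.inl (mem_k_iff.2 ?_))
      simp only [map_sub, lowerPart_raising, upperPart_raising, hA, sub_self, and_self]
    simpa only [sub_add_cancel] using add_mem hk hraising

end SO2n

end

noncomputable section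

attribute [local instance 100] LieRing.ofAssociativeRing

open scoped IsMulCommutative in
/-- Evaluation of polynomials at a commuting family of elements of a possibly noncommutative
algebra. -/
def PolyOp.commAeval {R A ι : Type*} [CommRing R] [Ring A] [Algebra R A] (x : ι → A)
    (hx : ∀ i j, Commute (x i) (x j)) : MvPolynomial ι R →ₐ[R] A :=
  haveI := Algebra.isMulCommutative_adjoin R (s := Set.range x) (by
    rintro _ ⟨i, rfl⟩ _ ⟨j, rfl⟩
    exact hx i j)
  (Algebra.adjoin R (Set.range x)).val.comp
    (MvPolynomial.aeval fun i => ⟨x i, Algebra.subset_adjoin ⟨i, rfl⟩⟩)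

lemma PolyOp.commAeval_X {R A ι : Type*} [CommRing R] [Ring A] [Algebra R A] {x : ι → A}
    (hx : ∀ i j, Commute (x i) (x j)) (i : ι) :
    commAeval (R := R) x hx (MvPolynomial.X i) = x i := by
  simp [commAeval]

namespace LieInduced

lemma smul_mem_of_mem_adjoin {R A M : Type*} [CommRing R] [Ring A] [Algebra R A] [AddCommGroup M]
    [Module R M] [Module A M] [IsScalarTower R A M] {s : Set A} {S : Submodule R M}
    (hS : ∀ a ∈ s, ∀ x ∈ S, a • x ∈ S) {a : A} (ha : a ∈ Algebra.adjoin R s) {x : M}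
    (hx : x ∈ S) : a • x ∈ S := by
  induction ha using Algebra.adjoin_induction generalizing x with
  | mem a ha => exact hS a ha x hx
  | algebraMap c => rw [algebraMap_smul]; exact S.smul_mem c hx
  | add a b _ _ iha ihb => rw [add_smul]; exact add_mem (iha hx) (ihb hx)
  | mul a b _ _ iha ihb => rw [mul_smul]; exact iha (ihb hx)

variable {R g V : Type*} [CommRing R] [LieRing g] [LieAlgebra R g] [AddCommGroup V] [Module R V]

lemma adjoin_range_ι : Algebra.adjoin R (Set.range
    (UniversalEnvelopingAlgebra.ι R : g →ₗ⁅R⁆ UniversalEnvelopingAlgebra R g)) = ⊤ := by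
  set S := Algebra.adjoin R (Set.range
    (UniversalEnvelopingAlgebra.ι R : g →ₗ⁅R⁆ UniversalEnvelopingAlgebra R g))
  let ιS : g →ₗ⁅R⁆ S :=
    { toFun := fun A => ⟨UniversalEnvelopingAlgebra.ι R A, Algebra.subset_adjoin ⟨A, rfl⟩⟩
      map_add' := fun A B => Subtype.ext (map_add _ A B)
      map_smul' := fun c A => Subtype.ext (map_smul _ c A)
      map_lie' := fun {A B} => Subtype.ext (LieHom.map_lie _ A B) }
  have h : S.val.comp (UniversalEnvelopingAlgebra.lift R ιS) =
      AlgHom.id R (UniversalEnvelopingAlgebra R g) := by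
    ext A
    exact congrArg Subtype.val (UniversalEnvelopingAlgebra.lift_ι_apply R ιS A)
  refine eq_top_iff.2 fun u _ => ?_
  rw [← AlgHom.id_apply (R := R) u, ← h]
  exact (UniversalEnvelopingAlgebra.lift R ιS u).2

namespace Ind

variable {q : LieSubalgebra R g} {ρ : q →ₗ⁅R⁆ Module.End R V}

lemma ι_smul_tmul_one (y : q) (v : V) :
    UniversalEnvelopingAlgebra.ι R (y : g) • tmul q ρ 1 v = tmul q ρ 1 (ρ y v) := by
  rw [tmul, tmul, ← map_smul, TensorProduct.smul_tmul', smul_eq_mul, mul_one]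
  exact (Submodule.Quotient.eq _).2 (Submodule.subset_span ⟨y, v, rfl⟩)

lemma eq_top_of_tmul_one_mem {S : Submodule R (Ind q ρ)}
    (hS : ∀ A : g, ∀ x ∈ S, UniversalEnvelopingAlgebra.ι R A • x ∈ S)
    (h1 : ∀ v, tmul q ρ 1 v ∈ S) :
    S = ⊤ := by
  refine eq_top_iff.2 fun x _ => ?_
  obtain ⟨t, rfl⟩ := Submodule.mkQ_surjective _ x
  induction t using TensorProduct.induction_on with
  | zero => rw [map_zero]; exact zero_mem S
  | add s t hs ht => rw [map_add]; exact add_mem (hs trivial) (ht trivial)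
  | tmul u v =>
    rw [← mul_one u, ← smul_eq_mul, ← TensorProduct.smul_tmul', map_smul]
    exact smul_mem_of_mem_adjoin (Set.forall_mem_range.2 hS)
      (by rw [adjoin_range_ι]; exact Algebra.mem_top) (h1 v)

section Lift

variable {M : Type*} [AddCommGroup M] [Module R M]

/-- The map `u ⊗ v ↦ u φ(v)` from `U(g) ⊗ V` to a `g`-module `(θ, M)`. -/
def preLift (θ : g →ₗ⁅R⁆ Module.End R M) (φ : V →ₗ[R] M) :
    UniversalEnvelopingAlgebra R g ⊗[R] V →ₗ[R] M :=
  TensorProduct.lift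
    ((LinearMap.lcomp R M φ).comp (UniversalEnvelopingAlgebra.lift R θ).toLinearMap)

variable (θ : g →ₗ⁅R⁆ Module.End R M) {φ : V →ₗ[R] M}

lemma preLift_tmul (u : UniversalEnvelopingAlgebra R g) (v : V) :
    preLift θ φ (u ⊗ₜ v) = UniversalEnvelopingAlgebra.lift R θ u (φ v) := rfl

lemma preLift_smul (u : UniversalEnvelopingAlgebra R g)
    (t : UniversalEnvelopingAlgebra R g ⊗[R] V) :
    preLift θ φ (u • t) = UniversalEnvelopingAlgebra.lift R θ u (preLift θ φ t) := by
  induction t using TensorProduct.induction_on with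
  | zero => simp only [smul_zero, map_zero]
  | add s t hs ht => simp only [smul_add, map_add, hs, ht]
  | tmul w v =>
    rw [TensorProduct.smul_tmul', smul_eq_mul, preLift_tmul, preLift_tmul, map_mul,
      Module.End.mul_apply]

lemma relations_le_ker_preLift (hφ : ∀ y v, φ (ρ y v) = θ y (φ v)) :
    (relations q ρ).restrictScalars R ≤ LinearMap.ker (preLift θ φ) := by
  intro t ht
  rw [LinearMap.mem_ker]
  induction ht using Submodule.span_induction with
  | mem t ht =>
    obtain ⟨y, v, rfl⟩ := ht
    rw [map_sub, preLift_tmul, preLift_tmul, map_one, Module.End.one_apply,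
      UniversalEnvelopingAlgebra.lift_ι_apply, hφ, sub_self]
  | zero => exact map_zero _
  | add s t _ _ hs ht => rw [map_add, hs, ht, add_zero]
  | smul u t _ ht => rw [preLift_smul, ht, map_zero]

/-- The universal property of the induced module: a `q`-linear map from `V` to a `g`-module
`(θ, M)` extends to the induced module. -/
def lift (hφ : ∀ y v, φ (ρ y v) = θ y (φ v)) : Ind q ρ →ₗ[R] M :=
  (Submodule.liftQ _ (preLift θ φ) (relations_le_ker_preLift θ hφ)).comp
    (Submodule.Quotient.restrictScalarsEquiv R (relations q ρ)).symm.toLinearMap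

variable (hφ : ∀ y v, φ (ρ y v) = θ y (φ v))

lemma lift_tmul_one (v : V) : lift θ hφ (tmul q ρ 1 v) = φ v := by
  change preLift θ φ (1 ⊗ₜ v) = φ v
  rw [preLift_tmul, map_one, Module.End.one_apply]

lemma lift_ι_smul (A : g) (x : Ind q ρ) :
    lift θ hφ (UniversalEnvelopingAlgebra.ι R A • x) = θ A (lift θ hφ x) := by
  obtain ⟨t, rfl⟩ := Submodule.mkQ_surjective _ x
  refine (preLift_smul θ _ t).trans ?_
  rw [UniversalEnvelopingAlgebra.lift_ι_apply]
  rfl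

end Lift

end Ind

end LieInduced

namespace SO2n

open Complex Matrix PolyOp

variable {n : ℕ}

lemma ι_mul_ι (A B : G n) : UniversalEnvelopingAlgebra.ι ℂ A * UniversalEnvelopingAlgebra.ι ℂ B =
    UniversalEnvelopingAlgebra.ι ℂ B * UniversalEnvelopingAlgebra.ι ℂ A +
      UniversalEnvelopingAlgebra.ι ℂ ⁅A, B⁆ := by
  rw [LieHom.map_lie, Ring.lie_def]
  abel

lemma lowering_lie (a b : Fin n → ℂ) : ⁅lowering n a, lowering n b⁆ = 0 := by
  apply ext_parts <;>
  simp [lowerPart_lie, upperPart_lie, weight₁_lie, rotPart_lie, weight₁_lowering,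
    rotPart_lowering, upperPart_lowering]

/-- The symmetric algebra of the abelian Lie algebra `p⁻`, mapped into `U(g)`. -/
def symbol (n : ℕ) : MvPolynomial (Fin n) ℂ →ₐ[ℂ] U n :=
  commAeval (fun i => UniversalEnvelopingAlgebra.ι ℂ (lowering n (Pi.single i 1))) fun i j => by
    rw [Commute, SemiconjBy, ι_mul_ι, lowering_lie, map_zero, add_zero]

lemma symbol_X (i : Fin n) : symbol n (MvPolynomial.X i) =
    UniversalEnvelopingAlgebra.ι ℂ (lowering n (Pi.single i 1)) := commAeval_X _ i

lemma symbol_linForm (a : Fin n → ℂ) :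
    symbol n (linForm a) = UniversalEnvelopingAlgebra.ι ℂ (lowering n a) := by
  have h : (symbol n).toLinearMap.comp linForm =
      (UniversalEnvelopingAlgebra.ι ℂ : G n →ₗ⁅ℂ⁆ U n).toLinearMap.comp (lowering n) :=
    LinearMap.pi_ext' fun i => LinearMap.ext_ring <| by
      change symbol n (linForm (Pi.single i 1)) = _
      rw [linForm_single, symbol_X]
      rfl
  exact LinearMap.congr_fun h a

lemma symbol_neg_rsq (hn : 1 ≤ n) : symbol n (-rsq) = Z n := by
  rw [← sum_linForm_eVec_mul, map_sum, Z]
  refine Finset.sum_congr rfl fun h hh => ?_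
  have habs : |h| ≠ 1 := (Finset.mem_filter.1 hh).2
  rw [X_neg_one hn habs, X_neg_one hn (by rwa [abs_neg]), map_mul, symbol_linForm, symbol_linForm]

variable (E₀ : ℝ)

lemma K_apply_one (A : q n) : K n E₀ A 1 = -(E₀ : ℂ) * weight₁ n A := mul_one _

lemma tmul_one (c : ℂ) : LieInduced.Ind.tmul (q n) (K n E₀) 1 c = c • vTop n E₀ := by
  refine congrArg (LieInduced.relations (q n) (K n E₀)).mkQ (?_ : _ = c • _)
  rw [← TensorProduct.tmul_smul, smul_eq_mul, mul_one]

lemma ι_smul_vTop (A : q n) : UniversalEnvelopingAlgebra.ι ℂ (A : G n) • vTop n E₀ =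
    (-(E₀ : ℂ) * weight₁ n A) • vTop n E₀ := by
  rw [vTop, LieInduced.Ind.ι_smul_tmul_one, tmul_one, K_apply_one, vTop]

lemma rep_C (A : G n) (c : ℂ) : rep n E₀ A (MvPolynomial.C c) =
    MvPolynomial.C c * (linForm (lowerPart n A) + MvPolynomial.C (-(E₀ : ℂ) * weight₁ n A)) := by
  rw [rep_apply, conf_C, ← MvPolynomial.algebraMap_eq, Derivation.map_algebraMap,
    Derivation.map_algebraMap, map_mul, map_neg]
  ring

lemma rep_lowering (a : Fin n → ℂ) (p : MvPolynomial (Fin n) ℂ) :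
    rep n E₀ (lowering n a) p = linForm a * p := by
  simp only [rep_apply, lowerPart_lowering, upperPart_lowering, weight₁_lowering, rotPart_lowering,
    map_zero, LinearMap.zero_apply, Derivation.zero_apply, zero_mul, add_zero, sub_zero]

lemma rep_lie (A B : G n) (p : MvPolynomial (Fin n) ℂ) :
    rep n E₀ ⁅A, B⁆ p = rep n E₀ A (rep n E₀ B p) - rep n E₀ B (rep n E₀ A p) := by
  rw [LieHom.map_lie, Ring.lie_def, LinearMap.sub_apply, Module.End.mul_apply,
    Module.End.mul_apply]

variable {E₀}

lemma ι_smul_symbol_smul_vTop (hn : 1 ≤ n) (p : MvPolynomial (Fin n) ℂ) (A : G n) :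
    UniversalEnvelopingAlgebra.ι ℂ A • symbol n p • vTop n E₀ =
      symbol n (rep n E₀ A p) • vTop n E₀ := by
  induction p using MvPolynomial.induction_on generalizing A with
  | C c =>
    have hq : A - lowering n (lowerPart n A) ∈ q n := by
      rw [mem_q_iff hn, map_sub, lowerPart_lowering, sub_self]
    have h := ι_smul_vTop E₀ ⟨_, hq⟩
    rw [map_sub, sub_smul, map_sub, weight₁_lowering, sub_zero, sub_eq_iff_eq_add'] at h
    rw [rep_C]
    simp only [← MvPolynomial.algebraMap_eq, map_mul, map_add, AlgHom.commutes, mul_smul,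
      add_smul, algebraMap_smul, symbol_linForm]
    rw [smul_comm, h, mul_smul]
  | add p q hp hq => simp only [map_add, add_smul, smul_add, hp, hq]
  | mul_X p i hp =>
    have hl (p) : rep n E₀ (lowering n (Pi.single i 1)) p = MvPolynomial.X i * p := by
      rw [rep_lowering, linForm_single]
    have hlie := rep_lie E₀ A (lowering n (Pi.single i 1)) p
    rw [hl, hl] at hlie
    rw [mul_comm, map_mul, symbol_X, mul_smul, ← mul_smul, ι_mul_ι, add_smul, mul_smul, hp, hp,
      hlie, ← mul_smul, ← symbol_X, ← map_mul, ← add_smul, ← map_add, add_sub_cancel]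

/-- The projection of `N(λ)` onto its polynomial model. -/
def toPoly (hn : 1 ≤ n) (E₀ : ℝ) : N n E₀ →ₗ[ℂ] MvPolynomial (Fin n) ℂ :=
  LieInduced.Ind.lift (rep n E₀) (φ := Algebra.linearMap ℂ _) fun y c => by
    change MvPolynomial.C (-(E₀ : ℂ) * weight₁ n y * c) = rep n E₀ y (MvPolynomial.C c)
    rw [rep_C, (mem_q_iff hn).1 y.2, map_zero, zero_add, mul_comm, map_mul]

lemma toPoly_vTop (hn : 1 ≤ n) : toPoly hn E₀ (vTop n E₀) = 1 :=
  (LieInduced.Ind.lift_tmul_one ..).trans (map_one (algebraMap ℂ _))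

lemma toPoly_ι_smul (hn : 1 ≤ n) (A : G n) (x : N n E₀) :
    toPoly hn E₀ (UniversalEnvelopingAlgebra.ι ℂ A • x) = rep n E₀ A (toPoly hn E₀ x) :=
  LieInduced.Ind.lift_ι_smul ..

lemma toPoly_symbol_smul (hn : 1 ≤ n) (p : MvPolynomial (Fin n) ℂ) (x : N n E₀) :
    toPoly hn E₀ (symbol n p • x) = p * toPoly hn E₀ x := by
  induction p using MvPolynomial.induction_on generalizing x with
  | C c =>
    rw [← MvPolynomial.algebraMap_eq, AlgHom.commutes, algebraMap_smul, map_smul, Algebra.smul_def]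
  | add p q hp hq => rw [map_add, add_smul, map_add, hp, hq, add_mul]
  | mul_X p i hp =>
    rw [map_mul, mul_smul, hp, symbol_X, toPoly_ι_smul, rep_lowering, linForm_single, mul_assoc]

/-- `N(λ)` is the space of polynomials, with `g` acting through `rep`. -/
def polyEquiv (hn : 1 ≤ n) (E₀ : ℝ) : MvPolynomial (Fin n) ℂ ≃ₗ[ℂ] N n E₀ :=
  let evalTop : MvPolynomial (Fin n) ℂ →ₗ[ℂ] N n E₀ :=
    { toFun := fun p => symbol n p • vTop n E₀
      map_add' := fun p q => by rw [map_add, add_smul]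
      map_smul' := fun c p => by rw [map_smul, smul_assoc, RingHom.id_apply] }
  LinearEquiv.ofBijective evalTop
    ⟨Function.LeftInverse.injective (g := toPoly hn E₀) fun p =>
        (toPoly_symbol_smul hn p _).trans (by rw [toPoly_vTop, mul_one]),
      LinearMap.range_eq_top.1 <| LieInduced.Ind.eq_top_of_tmul_one_mem
        (by
          rintro A _ ⟨p, rfl⟩
          exact ⟨_, (ι_smul_symbol_smul_vTop hn p A).symm⟩)
        (fun c => ⟨MvPolynomial.C c, by
          change symbol n (algebraMap ℂ _ c) • vTop n E₀ = _
          rw [AlgHom.commutes, algebraMap_smul, tmul_one]⟩)⟩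

lemma polyEquiv_apply (hn : 1 ≤ n) (p : MvPolynomial (Fin n) ℂ) :
    polyEquiv hn E₀ p = symbol n p • vTop n E₀ := rfl

lemma ι_smul_polyEquiv (hn : 1 ≤ n) (A : G n) (p : MvPolynomial (Fin n) ℂ) :
    UniversalEnvelopingAlgebra.ι ℂ A • polyEquiv hn E₀ p = polyEquiv hn E₀ (rep n E₀ A p) :=
  ι_smul_symbol_smul_vTop hn p A

lemma polyEquiv_eq_v (hn : 1 ≤ n) (l k : ℕ) :
    polyEquiv hn E₀ (linForm (eVec n 2) ^ l * (-rsq) ^ k) = v n E₀ l k := by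
  rw [polyEquiv_apply, map_mul, map_pow, map_pow, symbol_linForm, symbol_neg_rsq hn,
    ← X_neg_one hn (by norm_num), v]

lemma exists_mem_k (t : ℂ) {B : Matrix (Fin n) (Fin n) ℂ} (hB : Bᵀ = -B) :
    ∃ A ∈ k n, weight₁ n A = t ∧ rotPart n A = B := by
  refine ⟨⟨Matrix.fromBlocks !![0, -I * t; I * t, 0] 0 0 B, ?_⟩, fun a i => ⟨rfl, rfl⟩, ?_, rfl⟩
  · rw [mem_so']
    have h (i j) : B j i = -B i j := congrFun (congrFun hB i) j
    ext (i | i) (j | j)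
    · fin_cases i <;> fin_cases j <;>
        simp [eta, LieAlgebra.Orthogonal.indefiniteDiagonal, Matrix.mul_diagonal,
          Matrix.diagonal_mul]
    · simp [eta, LieAlgebra.Orthogonal.indefiniteDiagonal]
    · simp [eta, LieAlgebra.Orthogonal.indefiniteDiagonal]
    · simp [eta, LieAlgebra.Orthogonal.indefiniteDiagonal, Matrix.mul_diagonal,
        Matrix.diagonal_mul, h i j]
  · rw [weight₁_apply]
    change I * (-I * t) = t
    linear_combination -t * I_sq

lemma rep_of_mem_k {A : G n} (hA : A ∈ k n) (p : MvPolynomial (Fin n) ℂ) :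
    rep n E₀ A p = linField (rotPart n A) p - weight₁ n A • (euler p + (E₀ : ℂ) • p) := by
  rw [mem_k_iff] at hA
  rw [rep_apply, hA.1, hA.2, map_zero, map_zero, LinearMap.zero_apply, zero_mul,
    MvPolynomial.smul_eq_C_mul, MvPolynomial.smul_eq_C_mul]
  ring

lemma rep_raising (a : Fin n → ℂ) (p : MvPolynomial (Fin n) ℂ) :
    rep n E₀ (raising n a) p = conf (E₀ : ℂ) a p := by
  simp only [rep_apply, lowerPart_raising, upperPart_raising, weight₁_raising, rotPart_raising,
    map_zero, Derivation.zero_apply, zero_mul, add_zero, sub_zero, zero_add]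

section Submodules

variable {S : Submodule ℂ (MvPolynomial (Fin n) ℂ)}

lemma rotStable_of_rep_mem (hS : ∀ A ∈ k n, ∀ p ∈ S, rep n E₀ A p ∈ S) : RotStable S where
  euler_mem {p} hp := by
    obtain ⟨A, hA, hweight, hrot⟩ := exists_mem_k (n := n) 1 (B := 0) (by simp)
    have h := hS A hA p hp
    rw [rep_of_mem_k hA, hweight, hrot, map_zero, Derivation.zero_apply, zero_sub, one_smul] at h
    exact (S.add_mem_iff_left (S.smul_mem _ hp)).1 (neg_mem_iff.1 h)
  linField_mem {B} hB p hp := by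
    obtain ⟨A, hA, hweight, hrot⟩ := exists_mem_k 0 hB
    have h := hS A hA p hp
    rwa [rep_of_mem_k hA, hweight, hrot, zero_smul, sub_zero] at h

lemma confStable_of_rep_mem (hS : ∀ A, ∀ p ∈ S, rep n E₀ A p ∈ S) : ConfStable (E₀ : ℂ) S where
  toRotStable := rotStable_of_rep_mem fun A _ => hS A
  linForm_mem a p hp := rep_lowering E₀ a p ▸ hS _ p hp
  conf_mem a p hp := rep_raising a p ▸ hS _ p hp

lemma _root_.PolyOp.RotStable.rep_mem (hS : RotStable S) {A : G n} (hA : A ∈ k n)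
    {p : MvPolynomial (Fin n) ℂ} (hp : p ∈ S) : rep n E₀ A p ∈ S := by
  rw [rep_of_mem_k hA]
  exact S.sub_mem (hS.linField_mem (rotPart_transpose A) hp)
    (S.smul_mem _ (S.add_mem (hS.euler_mem hp) (S.smul_mem _ hp)))

lemma _root_.PolyOp.ConfStable.rep_mem (hS : ConfStable (E₀ : ℂ) S) (A : G n)
    {p : MvPolynomial (Fin n) ℂ} (hp : p ∈ S) : rep n E₀ A p ∈ S := by
  rw [rep_apply, ← MvPolynomial.smul_eq_C_mul, ← MvPolynomial.smul_eq_C_mul]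
  exact S.add_mem (S.sub_mem (S.add_mem (hS.linForm_mem _ hp) (hS.conf_mem _ hp))
    (S.smul_mem _ (S.add_mem (hS.euler_mem hp) (S.smul_mem _ hp))))
    (hS.linField_mem (rotPart_transpose A) hp)

/-- The polynomials corresponding to the elements of a `U(k)`-submodule of `N(λ)`. -/
def polys (hn : 1 ≤ n) (T : Submodule (Uk n) (N n E₀)) : Submodule ℂ (MvPolynomial (Fin n) ℂ) :=
  (T.restrictScalars ℂ).comap (polyEquiv hn E₀).toLinearMap

lemma mem_polys {hn : 1 ≤ n} {T : Submodule (Uk n) (N n E₀)} {p : MvPolynomial (Fin n) ℂ} :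
    p ∈ polys hn T ↔ polyEquiv hn E₀ p ∈ T := Iff.rfl

lemma rotStable_polys (hn : 1 ≤ n) (T : Submodule (Uk n) (N n E₀)) : RotStable (polys hn T) :=
  rotStable_of_rep_mem fun A hA p hp => by
    rw [mem_polys, ← ι_smul_polyEquiv]
    exact T.smul_mem ⟨_, Algebra.subset_adjoin ⟨A, hA, rfl⟩⟩ hp

lemma confStable_polys (hn : 1 ≤ n) (T : Submodule (U n) (N n E₀)) :
    ConfStable (E₀ : ℂ) (polys hn (T.restrictScalars (Uk n))) :=
  confStable_of_rep_mem fun A p hp => by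
    rw [mem_polys, ← ι_smul_polyEquiv]
    exact T.smul_mem _ hp

/-- The `U(g)`-submodule of `N(λ)` corresponding to a space of polynomials stable under the
conformal Lie algebra. -/
def _root_.PolyOp.ConfStable.toSubmodule (hn : 1 ≤ n) (hS : ConfStable (E₀ : ℂ) S) :
    Submodule (U n) (N n E₀) where
  __ := S.map (polyEquiv hn E₀).toLinearMap
  smul_mem' u x hx := LieInduced.smul_mem_of_mem_adjoin
    (S := S.map (polyEquiv hn E₀).toLinearMap) (s := Set.range (UniversalEnvelopingAlgebra.ι ℂ))
    (by
      rintro _ ⟨A, rfl⟩ _ ⟨p, hp, rfl⟩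
      exact ⟨_, hS.rep_mem A hp, (ι_smul_polyEquiv hn A p).symm⟩)
    (LieInduced.adjoin_range_ι (R := ℂ) (g := G n) ▸ Algebra.mem_top) hx

lemma polyEquiv_mem_toSubmodule {hn : 1 ≤ n} {hS : ConfStable (E₀ : ℂ) S}
    {p : MvPolynomial (Fin n) ℂ} : polyEquiv hn E₀ p ∈ hS.toSubmodule hn ↔ p ∈ S :=
  ⟨fun ⟨_, hq, h⟩ => (polyEquiv hn E₀).injective h ▸ hq, fun hp => ⟨p, hp, rfl⟩⟩

end Submodules

lemma exists_eVec_two_eq (hn : 2 ≤ n) : ∃ i k : Fin n, i ≠ k ∧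
    eVec n 2 = Pi.single i 1 + I • Pi.single k 1 ∧
    eVec n (-2) = (-(1 / 2) : ℂ) • (Pi.single i 1 - I • Pi.single k 1) := by
  obtain ⟨m, rfl⟩ := Nat.exists_eq_add_of_le' hn
  have h₁ : fVec (m + 2) (2 * 2 - 3) = Pi.single 0 1 := fVec_succ 0
  have h₂ : fVec (m + 2) (2 * 2 - 2) = Pi.single 1 1 := fVec_succ 1
  exact ⟨0, 1, zero_ne_one, h₁ ▸ h₂ ▸ eVec_pos le_rfl, h₁ ▸ h₂ ▸ eVec_neg le_rfl⟩

lemma eVec_two_dotProduct_self (hn : 2 ≤ n) : eVec n 2 ⬝ᵥ eVec n 2 = 0 := by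
  obtain ⟨i, k, hik, h, -⟩ := exists_eVec_two_eq hn
  simp [h, hik, hik.symm]

lemma eVec_neg_two_dotProduct_self (hn : 2 ≤ n) : eVec n (-2) ⬝ᵥ eVec n (-2) = 0 := by
  obtain ⟨i, k, hik, -, h⟩ := exists_eVec_two_eq hn
  simp [h, hik, hik.symm, mul_left_comm I]

lemma eVec_neg_two_dotProduct_eVec_two (hn : 2 ≤ n) : eVec n (-2) ⬝ᵥ eVec n 2 = -1 := by
  obtain ⟨i, k, hik, h, h'⟩ := exists_eVec_two_eq hn
  norm_num [h, h', hik, hik.symm, mul_left_comm I]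

lemma v_eq_smul_polyEquiv (hn : 1 ≤ n) (l k : ℕ) :
    v n E₀ l k = (-1 : ℂ) ^ k • polyEquiv hn E₀ (linForm (eVec n 2) ^ l * rsq ^ k) := by
  rw [← polyEquiv_eq_v hn, ← map_smul, ← neg_one_smul ℂ rsq, smul_pow, mul_smul_comm]

lemma v_mem_Ukv (l k : ℕ) : v n E₀ l k ∈ Ukv n E₀ l k := Submodule.mem_span_singleton_self _

lemma rsqMultiples_le_polys_iSup_Ukv (hn : 3 ≤ n) (j : ℕ) :
    rsqMultiples (Fin n) ℂ j ≤
      polys (by omega) (⨆ p : ℕ × ℕ, Ukv n E₀ p.1 (j + p.2)) := by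
  have hmem (l k : ℕ) : linForm (eVec n 2) ^ l * rsq ^ (j + k) ∈
      polys (by omega) (⨆ p : ℕ × ℕ, Ukv n E₀ p.1 (j + p.2)) := by
    have hsign : (-1 : ℂ) ^ (j + k) ≠ 0 := pow_ne_zero _ (neg_ne_zero.2 one_ne_zero)
    refine (Submodule.smul_mem_iff _ hsign).1 ?_
    rw [mem_polys, map_smul, ← v_eq_smul_polyEquiv]
    exact Submodule.mem_iSup_of_mem (l, k) (v_mem_Ukv l (j + k))
  refine (rotStable_polys _ _).rsqMultiples_le hmem (c := -eVec n (-2))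
    (eVec_two_dotProduct_self (by omega)) ?_ ?_ (by simpa using hn)
  · rw [neg_dotProduct_neg, eVec_neg_two_dotProduct_self (by omega)]
  · rw [neg_dotProduct, eVec_neg_two_dotProduct_eVec_two (by omega), neg_neg]

lemma iSup_Ukv (hn : 3 ≤ n) (E₀ : ℝ) : ⨆ p : ℕ × ℕ, Ukv n E₀ p.1 p.2 = ⊤ := by
  refine (Submodule.eq_top_iff').2 fun x => ?_
  obtain ⟨p, rfl⟩ := (polyEquiv (by omega) E₀).surjective x
  have hp : p ∈ rsqMultiples (Fin n) ℂ 0 := mem_rsqMultiples.2 ⟨p, by rw [pow_zero, one_mul]⟩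
  simpa only [zero_add] using mem_polys.1 (rsqMultiples_le_polys_iSup_Ukv hn 0 hp)

lemma mem_map_bigradedPart_of_mem_Ukv (hn : 2 ≤ n) {l k : ℕ} {x : N n E₀}
    (hx : x ∈ Ukv n E₀ l k) :
    x ∈ (bigradedPart (Fin n) ℂ l k).map (polyEquiv (by omega) E₀).toLinearMap := by
  obtain ⟨u, rfl⟩ := Submodule.mem_span_singleton.1 hx
  refine LieInduced.smul_mem_of_mem_adjoin
    (S := (bigradedPart (Fin n) ℂ l k).map (polyEquiv _ E₀).toLinearMap) ?_ u.2 ?_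
  · rintro _ ⟨A, hA, rfl⟩ _ ⟨p, hp, rfl⟩
    exact ⟨_, (rotStable_bigradedPart l k).rep_mem hA hp, (ι_smul_polyEquiv _ A p).symm⟩
  · rw [v_eq_smul_polyEquiv (by omega), mul_comm]
    exact Submodule.smul_mem _ _ (Submodule.mem_map_of_mem
      (rsq_pow_mul_mem_bigradedPart (euler_linForm_pow (eVec n 2) l)
        (laplacian_linForm_pow (eVec_two_dotProduct_self hn) l) k))

lemma iSupIndep_Ukv (hn : 3 ≤ n) (E₀ : ℝ) : iSupIndep fun p : ℕ × ℕ => Ukv n E₀ p.1 p.2 := by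
  have hn₁ : 1 ≤ n := by omega
  have h := LinearMap.iSupIndep_map (polyEquiv hn₁ E₀).toLinearMap (polyEquiv hn₁ E₀).injective
    (iSupIndep_bigradedPart (σ := Fin n) (K := ℂ) (by simpa using hn))
  rw [iSupIndep_iff_finsetSum_eq_zero_imp_eq_zero] at h ⊢
  exact fun s f hf => h s f fun i hi => mem_map_bigradedPart_of_mem_Ukv (by omega) (hf i hi)

/-- For `E₀ = n/2 - j`, the submodule of `N(λ)` corresponding to the multiples of `rsq ^ j`; for
`j ≥ 1` it is the largest proper submodule. -/
def maxSubmodule (hn : 1 ≤ n) {j : ℕ} (hE : E₀ = (n : ℝ) / 2 - j) : Submodule (U n) (N n E₀) :=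
  (confStable_rsqMultiples (σ := Fin n) (s := (E₀ : ℂ)) (j := j)
    (by rw [hE, Fintype.card_fin]; push_cast; ring)).toSubmodule hn

section MaxSubmodule

variable {j : ℕ} (hE : E₀ = (n : ℝ) / 2 - j)

lemma polyEquiv_mem_maxSubmodule {hn : 1 ≤ n} {p : MvPolynomial (Fin n) ℂ} :
    polyEquiv hn E₀ p ∈ maxSubmodule hn hE ↔ rsq ^ j ∣ p :=
  polyEquiv_mem_toSubmodule.trans mem_rsqMultiples

lemma restrictScalars_maxSubmodule (hn : 3 ≤ n) :
    (maxSubmodule (by omega) hE).restrictScalars (Uk n) =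
      ⨆ p : ℕ × ℕ, Ukv n E₀ p.1 (j + p.2) := by
  refine le_antisymm ?_ (iSup_le fun p => (Submodule.span_singleton_le_iff_mem ..).2 ?_)
  · intro x hx
    obtain ⟨p, rfl⟩ := (polyEquiv (by omega) E₀).surjective x
    rw [Submodule.restrictScalars_mem, polyEquiv_mem_maxSubmodule, ← mem_rsqMultiples] at hx
    exact mem_polys.1 (rsqMultiples_le_polys_iSup_Ukv hn j hx)
  · rw [Submodule.restrictScalars_mem, v_eq_smul_polyEquiv (by omega)]
    refine Submodule.smul_of_tower_mem _ _ ((polyEquiv_mem_maxSubmodule hE).2 ?_)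
    exact (pow_dvd_pow rsq (Nat.le_add_right j p.2)).mul_left _

lemma maxSubmodule_ne_top (hn : 1 ≤ n) (hj : j ≠ 0) : maxSubmodule hn hE ≠ ⊤ := by
  intro h
  have h1 : polyEquiv hn E₀ 1 ∈ maxSubmodule hn hE := h ▸ Submodule.mem_top
  obtain ⟨p, hp⟩ := (dvd_pow_self rsq hj).trans ((polyEquiv_mem_maxSubmodule hE).1 h1)
  simpa [rsq] using congrArg (MvPolynomial.eval 0) hp

lemma maxSubmodule_ne_bot (hn : 1 ≤ n) : maxSubmodule hn hE ≠ ⊥ := by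
  intro h
  have : Nonempty (Fin n) := ⟨⟨0, hn⟩⟩
  have hmem := (polyEquiv_mem_maxSubmodule (hn := hn) hE).2 (dvd_refl (rsq ^ j))
  rw [h, Submodule.mem_bot, LinearEquiv.map_eq_zero_iff] at hmem
  exact pow_ne_zero j rsq_ne_zero hmem

end MaxSubmodule

lemma eq_top_of_one_mem_polys {hn : 1 ≤ n} {T : Submodule (U n) (N n E₀)}
    (h1 : 1 ∈ polys hn (T.restrictScalars (Uk n))) : T = ⊤ := by
  refine (Submodule.eq_top_iff').2 fun x => ?_
  obtain ⟨p, rfl⟩ := (polyEquiv hn E₀).surjective x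
  have hp : p ∈ polys hn (T.restrictScalars (Uk n)) :=
    (confStable_polys hn T).eq_top h1 ▸ Submodule.mem_top
  exact hp

lemma natCast_add_ne_zero (hE₀ : 0 < E₀) (d : ℕ) : (d : ℂ) + E₀ ≠ 0 := by
  exact_mod_cast (by positivity : (d : ℝ) + E₀ ≠ 0)

lemma le_maxSubmodule (hn : 2 ≤ n) (hE₀ : 0 < E₀) {j : ℕ} (hE : E₀ = (n : ℝ) / 2 - j)
    {T : Submodule (U n) (N n E₀)} (hT : T ≠ ⊤) : T ≤ maxSubmodule (by omega) hE := by
  have : Nontrivial (Fin n) := Fin.nontrivial_iff_two_le.2 hn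
  intro x hx
  obtain ⟨p, rfl⟩ := (polyEquiv (by omega) E₀).surjective x
  rw [polyEquiv_mem_maxSubmodule, ← mem_rsqMultiples (K := ℂ)]
  refine (confStable_polys _ T).le_rsqMultiples (natCast_add_ne_zero hE₀) ?_
    (fun h1 => hT (eq_top_of_one_mem_polys h1)) hx
  rw [hE, Fintype.card_fin]
  push_cast
  ring

lemma isSimpleModule_N (hn : 2 ≤ n) (hE₀ : 0 < E₀)
    (hE : ∀ j : ℕ, 1 ≤ j → E₀ ≠ (n : ℝ) / 2 - j) : IsSimpleModule (U n) (N n E₀) := by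
  have : Nontrivial (Fin n) := Fin.nontrivial_iff_two_le.2 hn
  have hn₁ : 1 ≤ n := by omega
  have : Nontrivial (N n E₀) := (polyEquiv hn₁ E₀).symm.toEquiv.nontrivial
  refine { eq_bot_or_eq_top := fun T => or_iff_not_imp_left.2 fun hT => ?_ }
  refine eq_top_of_one_mem_polys ((confStable_polys hn₁ T).one_mem (natCast_add_ne_zero hE₀)
    (fun j hj h => hE j hj ?_) fun h => hT ?_)
  · rw [Fintype.card_fin] at h
    have h' : (n : ℝ) = 2 * (E₀ + j) := by exact_mod_cast h
    linarith
  · refine (Submodule.eq_bot_iff _).2 fun x hx => ?_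
    obtain ⟨p, rfl⟩ := (polyEquiv hn₁ E₀).surjective x
    have hp : p ∈ polys hn₁ (T.restrictScalars (Uk n)) := hx
    rw [h, Submodule.mem_bot] at hp
    rw [hp, map_zero]

lemma isGreatest_maxSubmodule (hn : 2 ≤ n) (hE₀ : 0 < E₀) {j : ℕ} (hj : j ≠ 0)
    (hE : E₀ = (n : ℝ) / 2 - j) :
    IsGreatest {T | T ≠ ⊤} (maxSubmodule (by omega) hE) :=
  ⟨maxSubmodule_ne_top hE _ hj, fun _ => le_maxSubmodule hn hE₀ hE⟩

lemma isSimpleModule_N_iff (hn : 2 ≤ n) (hE₀ : 0 < E₀) :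
    IsSimpleModule (U n) (N n E₀) ↔ ∀ j : ℕ, 1 ≤ j → E₀ ≠ (n : ℝ) / 2 - j := by
  refine ⟨fun hsimple j hj hE => ?_, isSimpleModule_N hn hE₀⟩
  rcases hsimple.eq_bot_or_eq_top (maxSubmodule (by omega) hE) with h | h
  · exact maxSubmodule_ne_bot hE _ h
  · exact maxSubmodule_ne_top hE _ (by omega) h

lemma le_of_eq_half_sub (hE₀ : 0 < E₀) {j : ℕ} (hE : E₀ = (n : ℝ) / 2 - j) : j ≤ (n - 1) / 2 := by
  have h : 2 * j < n := by exact_mod_cast (by linarith : (2 * j : ℝ) < n)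
  omega

lemma isCompl_iSup_Ukv (hn : 3 ≤ n) (E₀ : ℝ) (j : ℕ) :
    IsCompl (⨆ p : ℕ × Fin j, Ukv n E₀ p.1 p.2) (⨆ p : ℕ × ℕ, Ukv n E₀ p.1 (j + p.2)) :=
  isCompl_iSup_of_isCompl_range (t := fun p : ℕ × ℕ => Ukv n E₀ p.1 p.2)
    (f := fun p : ℕ × Fin j => (p.1, (p.2 : ℕ))) (g := fun p : ℕ × ℕ => (p.1, j + p.2))
    (iSupIndep_Ukv hn E₀) (iSup_Ukv hn E₀) (isCompl_range_lt_range_add j)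

lemma iSupIndep_Ukv_add (hn : 3 ≤ n) (E₀ : ℝ) (j : ℕ) :
    iSupIndep fun p : ℕ × ℕ => Ukv n E₀ p.1 (j + p.2) :=
  (iSupIndep_Ukv hn E₀).comp (f := fun p : ℕ × ℕ => (p.1, j + p.2)) fun p q h => by
    simpa [Prod.ext_iff] using h

lemma iSupIndep_Ukv_fin (hn : 3 ≤ n) (E₀ : ℝ) (j : ℕ) :
    iSupIndep fun p : ℕ × Fin j => Ukv n E₀ p.1 p.2 :=
  (iSupIndep_Ukv hn E₀).comp (f := fun p : ℕ × Fin j => (p.1, (p.2 : ℕ))) fun p q h => by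
    simpa [Prod.ext_iff, Fin.ext_iff] using h

end SO2n

end

theorem mainTheorem5 (n : ℕ) (hn : 3 ≤ n) (E₀ : ℝ) (hE : 0 < E₀) :
    DirectSum.IsInternal (fun p : ℕ × ℕ => SO2n.Ukv n E₀ p.1 p.2) ∧
    (IsSimpleModule (SO2n.U n) (SO2n.N n E₀) ↔
      E₀ ∉ {x : ℝ | ∃ j : ℕ, 1 ≤ j ∧ j ≤ (n - 1) / 2 ∧ x = (n : ℝ) / 2 - j}) ∧
    ∀ j : ℕ, 1 ≤ j → j ≤ (n - 1) / 2 → E₀ = (n : ℝ) / 2 - j →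
      IsSimpleModule (SO2n.U n) (SO2n.L n E₀) ∧
      iSupIndep (fun p : ℕ × ℕ => SO2n.Ukv n E₀ p.1 (j + p.2)) ∧
      (∃ W : Submodule (SO2n.U n) (SO2n.N n E₀),
        W.restrictScalars (SO2n.Uk n) = ⨆ p : ℕ × ℕ, SO2n.Ukv n E₀ p.1 (j + p.2) ∧
        ∃ φ : SO2n.L n E₀ ≃ₗ[SO2n.U n] (SO2n.N n E₀ ⧸ W),
          ∀ x : SO2n.N n E₀, φ (Submodule.Quotient.mk x) = Submodule.Quotient.mk x) ∧
      ∃ ψ : (⨁ p : ℕ × Fin j, SO2n.Ukv n E₀ p.1 p.2) ≃ₗ[SO2n.Uk n] SO2n.L n E₀,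
        ∀ (p : ℕ × Fin j) (x : SO2n.Ukv n E₀ p.1 p.2),
          ψ (DirectSum.lof (SO2n.Uk n) (ℕ × Fin j) (fun p => SO2n.Ukv n E₀ p.1 p.2) p x) =
            Submodule.Quotient.mk (x : SO2n.N n E₀) := by
  refine ⟨DirectSum.isInternal_submodule_of_iSupIndep_of_iSup_eq_top (SO2n.iSupIndep_Ukv hn E₀)
    (SO2n.iSup_Ukv hn E₀), ?_, fun j hj _ hEj => ?_⟩
  · rw [SO2n.isSimpleModule_N_iff (by omega) hE]
    exact ⟨fun h ⟨j, hj, _, hEj⟩ => h j hj hEj,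
      fun h j hj hEj => h ⟨j, hj, SO2n.le_of_eq_half_sub hE hEj, hEj⟩⟩
  · have hmax := SO2n.isGreatest_maxSubmodule (by omega) hE (by omega) hEj
    have hL : LieInduced.maxProper (SO2n.U n) (SO2n.N n E₀) = SO2n.maxSubmodule (by omega) hEj :=
      hmax.isLUB.sSup_eq
    have hres := SO2n.restrictScalars_maxSubmodule hEj hn
    have hcompl := SO2n.isCompl_iSup_Ukv hn E₀ j
    rw [← hres, ← hL] at hcompl
    refine ⟨?_, SO2n.iSupIndep_Ukv_add hn E₀ j,
      ⟨_, hres, Submodule.quotEquivOfEq _ _ hL, fun x => rfl⟩,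
      directSumEquivQuotient (SO2n.iSupIndep_Ukv_fin hn E₀ j) hcompl ≪≫ₗ
        Submodule.Quotient.restrictScalarsEquiv (SO2n.Uk n) _, fun p x => ?_⟩
    · rw [isSimpleModule_iff_isCoatom, hL]
      exact isCoatom_of_isGreatest_ne_top hmax
    · rw [LinearEquiv.trans_apply, directSumEquivQuotient_lof]
      rfl
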